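/- Let $q>2$ be even (a power of $2$), let $V=\mathbb F_q^6$ and $\mathbf e_1=(1,0,0,0,0,0)$. Let $\mathbb O$ be the octonion algebra over $\mathbb F_q$ with basis $\mathbf x_1,\dots,\mathbf x_8$ whose nonzero products of basis vectors are $\mathbf x_1=\mathbf x_1\mathbf x_5=\mathbf x_2\mathbf x_3=\mathbf x_3\mathbf x_2=\mathbf x_4\mathbf x_1$, $\mathbf x_2=\mathbf x_1\mathbf x_6=\mathbf x_2\mathbf x_4=\mathbf x_5\mathbf x_2=\mathbf x_6\mathbf x_1$, $\mathbf x_3=\mathbf x_1\mathbf x_7=\mathbf x_3\mathbf x_4=\mathbf x_5\mathbf x_3=\mathbf x_7\mathbf x_1$, $\mathbf x_4=\mathbf x_1\mathbf x_8=\mathbf x_4\mathbf x_4=\mathbf x_6\mathbf x_3=\mathbf x_7\mathbf x_2$, $\mathbf x_5=\mathbf x_2\mathbf x_7=\mathbf x_3\mathbf x_6=\mathbf x_5\mathbf x_5=\mathbf x_8\mathbf x_1$, $\mathbf x_6=\mathbf x_2\mathbf x_8=\mathbf x_4\mathbf x_6=\mathbf x_6\mathbf x_5=\mathbf x_8\mathbf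 x_2$, $\mathbf x_7=\mathbf x_3\mathbf x_8=\mathbf x_4\mathbf x_7=\mathbf x_7\mathbf x_5=\mathbf x_8\mathbf x_3$, $\mathbf x_8=\mathbf x_5\mathbf x_8=\mathbf x_6\mathbf x_7=\mathbf x_7\mathbf x_6=\mathbf x_8\mathbf x_4$; its identity is $\mathbf e=\mathbf x_4+\mathbf x_5$. Let $f$ be the bilinear form with $f(\mathbf x_i,\mathbf x_j)=1$ if $i+j=9$ and $0$ otherwise, and let $\mathbf e^\perp$ be the orthogonal complement of $\mathbf e$ with respect to $f$. The group $G_2(q)$ is the automorphism group of $\mathbb O$; it acts on $\mathbf e^\perp/\langle\mathbf e\rangle$, and hence on $V$ through an arbitrary fixed $\mathbb F_q$-linear isomorphism $\mathbf e^\perp/\langle\mathbf e\rangle\to V$. Let $G\le \mathrm{A\Gamma L}(6,q)$ be $2$-transitive on $V$ such that the stabilizer $G_{\mathbf 0}$ of the zero vector contains $G_2(q)$ (as a permutation group on $V$) as a normal subgroup. Suppose that $P$ is a nontrivial imprimitive block of $G_{\mathbf 0}$ on $V\setminus\{\mathbf 0\}$ (that is, $1<|P|<|V\setminus\{\mathbf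 0\}|$, and $P^g=P$ or $P^g\cap P=\emptyset$ for all $g\in G_{\mathbf 0}$) with $\mathbf e_1\in P$. Then the following hold. (a) $P\subseteq\langle\mathbf e_1\rangle$, and $\{a\in\mathbb F_q^\times \mid a\mathbf e_1\in P\}$ is a subgroup of $\mathbb F_q^\times$. (b) Put $L:=P\cup\{\mathbf 0\}$. Then $\mathcal D:=(V,L^G)$ is a $2$-$(q^6,|P|+1,\lambda)$ design admitting $G$ as a group of automorphisms, where $\lambda=1$ or $\lambda=|P|+1$, and $\Omega:=(\mathbf 0,L)^G$ is a strongly feasible $G$-orbit on the flag set of $\mathcal D$. Here strongly feasible means that $\mathcal D$ is a $G$-point-transitive and $G$-block-transitive $1$-design with block size at least $2$, that each point $\sigma$ is the point entry of at least two flags of $\Omega$, that $G_{\sigma,M}$ is transitive on $M\setminus\{\sigma\}$ for every $(\sigma,M)\in\Omega$, and that $M\cap N=\{\sigma\}$ for any two distinct flags $(\sigma,M),(\sigma,N)\in\Omega$. Moreover, $\lambda=1$ if and only if $\{a\in\mathbb F_q^\times\mid a\mathbf e_1\in P\}\cup\{0\}$ is a subfield of $\mathbb F_q$. (c) The set $\Xi:=\{((\sigma,M),(\tau,N))\in\Omega\times\Omega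 \mid \sigma\ne\tau,\ \sigma,\tau\in M\cap N\}$ is a (self-paired) $G$-orbit, and the $G$-flag graph $\Gamma(\mathcal D,\Omega,\Xi)$, with vertex set $\Omega$ and arc set $\Xi$, is disconnected. -/

import Mathlib

open scoped Pointwise

/-! ### Affine semilinear groups -/

/-- The group `AΓL(V)` of all permutations `x ↦ A x + c` of a vector space `V` over `F`, where `c`
is a vector and `A` is a bijective semilinear map (with respect to some automorphism of `F`). -/
def affineSemilinearGroup (F V : Type*) [Field F] [AddCommGroup V] [Module F V] :
    Subgroup (Equiv.Perm V) where
  carrier := {g | ∃ (s : F ≃+* F) (A : V ≃+ V) (c : V),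
    (∀ (a : F) (x : V), A (a • x) = s a • A x) ∧ ∀ x, g x = A x + c}
  one_mem' := ⟨RingEquiv.refl F, AddEquiv.refl V, 0, by simp, by simp⟩
  mul_mem' := by
    rintro g h ⟨s, A, c, hA, hg⟩ ⟨t, B, d, hB, hh⟩
    refine ⟨t.trans s, B.trans A, A d + c, fun a x => by simp [hA, hB], fun x => ?_⟩
    simp [hg, hh, add_assoc]
  inv_mem' := by
    rintro g ⟨s, A, c, hA, hg⟩
    refine ⟨s.symm, A.symm, -A.symm c, fun a x => ?_, fun x => ?_⟩
    · apply A.injective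
      simp [hA]
    · rw [Equiv.Perm.inv_eq_iff_eq, hg]
      simp

/-! ### The octonion algebra in characteristic two and the group `G₂(q)` -/

section Octonions

variable {F : Type*} [Field F]

/-- The multiplication of the (split) octonion algebra over a field of characteristic two.
A vector `x : Fin 8 → F` stands for `x 0 • x₁ + x 1 • x₂ + ⋯ + x 7 • x₈`, where the products of
the basis vectors are
`x₁ = x₁x₅ = x₂x₃ = x₃x₂ = x₄x₁`, `x₂ = x₁x₆ = x₂x₄ = x₅x₂ = x₆x₁`,
`x₃ = x₁x₇ = x₃x₄ = x₅x₃ = x₇x₁`, `x₄ = x₁x₈ = x₄x₄ = x₆x₃ = x₇x₂`,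
`x₅ = x₂x₇ = x₃x₆ = x₅x₅ = x₈x₁`, `x₆ = x₂x₈ = x₄x₆ = x₆x₅ = x₈x₂`,
`x₇ = x₃x₈ = x₄x₇ = x₇x₅ = x₈x₃`, `x₈ = x₅x₈ = x₆x₇ = x₇x₆ = x₈x₄`,
and all other products of two basis vectors are zero. -/
def octMul (x y : Fin 8 → F) : Fin 8 → F :=
  ![x 0 * y 4 + x 1 * y 2 + x 2 * y 1 + x 3 * y 0,
    x 0 * y 5 + x 1 * y 3 + x 4 * y 1 + x 5 * y 0,
    x 0 * y 6 + x 2 * y 3 + x 4 * y 2 + x 6 * y 0,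
    x 0 * y 7 + x 3 * y 3 + x 5 * y 2 + x 6 * y 1,
    x 1 * y 6 + x 2 * y 5 + x 4 * y 4 + x 7 * y 0,
    x 1 * y 7 + x 3 * y 5 + x 5 * y 4 + x 7 * y 1,
    x 2 * y 7 + x 3 * y 6 + x 6 * y 4 + x 7 * y 2,
    x 4 * y 7 + x 5 * y 6 + x 6 * y 5 + x 7 * y 3]

/-- The identity element `e = x₄ + x₅` of the octonion algebra. -/
def octOne : Fin 8 → F := ![0, 0, 0, 1, 1, 0, 0, 0]

/-- The bilinear form `f` with `f(xᵢ, xⱼ) = 1` if `i + j = 9` and `0` otherwise. -/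
def octForm (x y : Fin 8 → F) : F := ∑ i, x i * y i.rev

variable (F) in
/-- `e^⊥`, the orthogonal complement of the identity element with respect to `f`. -/
def octPerp : Submodule F (Fin 8 → F) where
  carrier := {x | octForm x octOne = 0}
  zero_mem' := by simp [octForm]
  add_mem' := by
    intro x y hx hy
    simp only [Set.mem_ofPred_eq, octForm, Pi.add_apply, add_mul, Finset.sum_add_distrib] at *
    rw [hx, hy, add_zero]
  smul_mem' := by
    intro a x hx
    simp only [Set.mem_ofPred_eq, octForm, Pi.smul_apply, smul_eq_mul, mul_assoc,
      ← Finset.mul_sum] at *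
    rw [hx, mul_zero]

variable (F) in
/-- The six-dimensional space `e^⊥ / ⟨e⟩` (in characteristic two, `e ∈ e^⊥`). -/
abbrev OctSix : Type _ := octPerp F ⧸ (Submodule.span F {(octOne : Fin 8 → F)}).submoduleOf (octPerp F)

variable (F) in
/-- The group of all algebra automorphisms of the octonion algebra over `F`;
this is `G₂(q)` if `F` is the field with `q` elements, `q` even. -/
def octAut : Subgroup ((Fin 8 → F) ≃ₗ[F] (Fin 8 → F)) where
  carrier := {g | ∀ x y, g (octMul x y) = octMul (g x) (g y)}
  one_mem' := fun _ _ => rfl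
  mul_mem' := by
    intro g h hg hh x y
    simp only [Set.mem_ofPred_eq, LinearEquiv.mul_apply] at *
    rw [hh, hg]
  inv_mem' := by
    intro g hg x y
    apply g.injective
    have key : ∀ z, g (g⁻¹ z) = z := fun z => g.apply_symm_apply z
    rw [hg, key, key, key]

lemma octOne_mul (x : Fin 8 → F) : octMul octOne x = x := by
  ext i; fin_cases i <;> simp [octMul, octOne]

lemma mul_octOne (x : Fin 8 → F) : octMul x octOne = x := by
  ext i; fin_cases i <;> simp [octMul, octOne]

lemma octForm_octOne (x : Fin 8 → F) : octForm x octOne = x 3 + x 4 := by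
  simp [octForm, octOne, Fin.sum_univ_eight, Fin.rev]

lemma octMul_self [CharP F 2] (x : Fin 8 → F) : octMul x x = octForm x octOne • x +
    (x 0 * x 7 + x 1 * x 6 + x 2 * x 5 + x 3 * x 4) • octOne := by
  have h2 : (2 : F) = 0 := CharTwo.two_eq_zero
  rw [octForm_octOne]
  ext i
  fin_cases i <;> simp [octMul, octOne] <;> grind

lemma octAut_octOne {g : (Fin 8 → F) ≃ₗ[F] (Fin 8 → F)} (hg : g ∈ octAut F) :
    g octOne = octOne := by
  have h := hg octOne (g.symm octOne)
  rw [octOne_mul, g.apply_symm_apply, mul_octOne] at h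
  exact h.symm

/-- Algebra automorphisms leave `e^⊥` invariant. -/
lemma octAut_mem_octPerp [CharP F 2] {g : (Fin 8 → F) ≃ₗ[F] (Fin 8 → F)} (hg : g ∈ octAut F)
    {x : Fin 8 → F} (hx : x ∈ octPerp F) : g x ∈ octPerp F := by
  have h2 : (2 : F) = 0 := CharTwo.two_eq_zero
  change octForm (g x) octOne = 0
  have hx' : octForm x octOne = 0 := hx
  have h := hg x x
  rw [octMul_self, octMul_self, map_add, map_smul, map_smul, hx', octAut_octOne hg, zero_smul,
    zero_add] at h
  by_contra ht
  have h3 := congrFun h 3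
  have h4 := congrFun h 4
  rw [octForm_octOne] at *
  simp [octOne] at h3 h4
  apply ht
  have : (g x 3 + g x 4) * (g x 3 + g x 4) = 0 := by grind
  simpa using this

/-- The group `G₂(q)` as a permutation group on a vector space `V` that is identified with
`e^⊥ / ⟨e⟩` by a linear isomorphism `m`: it consists of the permutations of `V` that are induced
by the automorphisms of the octonion algebra. -/
def G2Perm [CharP F 2] {V : Type*} [AddCommGroup V] [Module F V] (m : OctSix F ≃ₗ[F] V) :
    Subgroup (Equiv.Perm V) where
  carrier := {h | ∃ (g : (Fin 8 → F) ≃ₗ[F] (Fin 8 → F)) (hg : g ∈ octAut F), ∀ x : octPerp F,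
    h (m (Submodule.Quotient.mk x)) =
      m (Submodule.Quotient.mk ⟨g x, octAut_mem_octPerp hg x.2⟩)}
  one_mem' := ⟨1, one_mem _, fun _ => rfl⟩
  mul_mem' := by
    rintro h k ⟨g, hg, hh⟩ ⟨g', hg', hk⟩
    refine ⟨g * g', mul_mem hg hg', fun x => ?_⟩
    rw [Equiv.Perm.mul_apply, hk, hh]
    rfl
  inv_mem' := by
    rintro h ⟨g, hg, hh⟩
    refine ⟨g⁻¹, inv_mem hg, fun x => ?_⟩
    rw [Equiv.Perm.inv_eq_iff_eq, hh]
    congr 2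
    exact Subtype.ext (g.apply_symm_apply x.1).symm

end Octonions

/-! ### Designs, flags and flag graphs -/

section Designs

variable {V : Type*}

/-- `(V, 𝓑)` is a `t`-`(v, k, l)` design without repeated blocks: there are `v` points, every block
has `k` points, and any `t` distinct points lie together in exactly `l ≥ 1` blocks. -/
structure IsDesign (t v k l : ℕ) (𝓑 : Set (Set V)) : Prop where
  finite : Finite V
  card_points : Nat.card V = v
  card_block : ∀ B ∈ 𝓑, B.ncard = k
  pos : 0 < l
  card_through : ∀ T : Finset V, T.card = t → {B ∈ 𝓑 | (T : Set V) ⊆ B}.ncard = l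

/-- `Ω(σ)`: the set of flags in `Ω` with point entry `σ`. -/
def flagsAt (Ω : Set (V × Set V)) (σ : V) : Set (V × Set V) := {w ∈ Ω | w.1 = σ}

/-- `Ω` is a feasible `G`-orbit on the flags of the `G`-point-transitive and `G`-block-transitive
`1`-design `(V, 𝓑)` with block size at least two. -/
structure IsFeasible (G : Subgroup (Equiv.Perm V)) (𝓑 : Set (Set V)) (Ω : Set (V × Set V)) :
    Prop where
  design : ∃ k l : ℕ, 2 ≤ k ∧ IsDesign 1 (Nat.card V) k l 𝓑
  point_transitive : MulAction.IsPretransitive G V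
  block_transitive : ∃ B : Set V, 𝓑 = MulAction.orbit G B
  flag_orbit : ∃ w : V × Set V, w.1 ∈ w.2 ∧ w.2 ∈ 𝓑 ∧ Ω = MulAction.orbit G w
  two_le : ∀ σ : V, 2 ≤ (flagsAt Ω σ).ncard
  transitive : ∀ (σ : V) (L : Set V), (σ, L) ∈ Ω → ∀ x ∈ L \ {σ}, ∀ y ∈ L \ {σ},
    ∃ g : G, g • σ = σ ∧ g • L = L ∧ g • x = y

/-- `Ω` is a strongly feasible `G`-orbit on the flags of `(V, 𝓑)`. -/
structure IsStronglyFeasible (G : Subgroup (Equiv.Perm V)) (𝓑 : Set (Set V))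
    (Ω : Set (V × Set V)) : Prop extends IsFeasible G 𝓑 Ω where
  inter_eq : ∀ (σ : V) (L N : Set V), (σ, L) ∈ Ω → (σ, N) ∈ Ω → L ≠ N → L ∩ N = {σ}

/-- The set `Ξ` of all pairs `((σ, L), (τ, N))` of flags in `Ω` with `σ ≠ τ` and
`σ, τ ∈ L ∩ N`. -/
def flagPairs (Ω : Set (V × Set V)) : Set ((V × Set V) × (V × Set V)) :=
  {p | p.1 ∈ Ω ∧ p.2 ∈ Ω ∧ p.1.1 ≠ p.2.1 ∧ p.1.1 ∈ p.1.2 ∩ p.2.2 ∧ p.2.1 ∈ p.1.2 ∩ p.2.2}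

/-- The flag graph with vertex set `Ω` and arc set `Ξ`. -/
def flagGraph (Ω : Set (V × Set V)) : SimpleGraph Ω where
  Adj w z := ((w : V × Set V), (z : V × Set V)) ∈ flagPairs Ω
  symm := ⟨by
    rintro w z ⟨h1, h2, h3, h4, h5⟩
    exact ⟨h2, h1, h3.symm, ⟨h5.2, h5.1⟩, ⟨h4.2, h4.1⟩⟩⟩
  loopless := ⟨fun _ h => h.2.2.1 rfl⟩

end Designs

/-! Write vectors of `e^⊥ / ⟨e⟩` as `(u, v)` with `u, v` in `F³`, so that the induced symplectic
form is `u·v' + v·u'`. Explicit root elements of `G₂(q)` show that the group is transitive on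
nonzero vectors (`sixRel_sixBase`) and on ordered pairs with a given nonzero form value
(`sixPairRel_of_sixForm_eq`). Consequently a block containing two non-orthogonal vectors is the set
of all nonzero vectors (`IsSixBlock.mem_of_sixForm_ne_zero`), and a block containing two
non-proportional vectors contains two non-orthogonal ones (`IsSixBlock.exists_sixForm_ne_zero`). A
nontrivial block therefore lies on a line. Linearity and transitivity make its set of coefficients a
multiplicative group, so `L = K e₁`, where `K` is a subgroup of `Fˣ` together with zero.

The rest depends only on `K` and on 2-transitivity. Subgroups of the cyclic group `Fˣ` are stable
under field automorphisms, so semilinear affine maps permute the sets `c + K (d - c)`. Such a set is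
determined by its centre `c` and any other point of it. Thus blocks, flags and arcs all come from
ordered pairs `c ≠ d`, and each kind forms one `G`-orbit. If `K` is closed under `a ↦ 1 + a`, it is
a subfield, the blocks are affine `K`-lines and `λ = 1`. Otherwise a block has only one centre, and
counting the possible centres of blocks through two points gives `λ = |K|`. Adjacent flags lie on
the same `F`-line, so the flag graph is disconnected. -/

/-! ### Coordinates on the six-dimensional module and the invariant form -/

section SixDimensional
variable {F : Type*} [Field F]

/-- The representative in `e^⊥` of a vector of `e^⊥ / ⟨e⟩` that is given by its coordinates with
respect to `x₁, x₆, x₇, x₈, x₃, x₂`. -/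
def sixLift : (Fin 6 → F) →ₗ[F] (Fin 8 → F) where
  toFun y := ![y 0, y 5, y 4, 0, 0, y 1, y 2, y 3]
  map_add' x y := by ext i; fin_cases i <;> simp
  map_smul' a y := by ext i; fin_cases i <;> simp

/-- The coordinates with respect to `x₁, x₆, x₇, x₈, x₃, x₂`. -/
def sixProj : (Fin 8 → F) →ₗ[F] (Fin 6 → F) where
  toFun x := ![x 0, x 5, x 6, x 7, x 2, x 1]
  map_add' x y := by ext i; fin_cases i <;> simp
  map_smul' a y := by ext i; fin_cases i <;> simp

lemma sixLift_apply (y : Fin 6 → F) :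
    sixLift y = ![y 0, y 5, y 4, 0, 0, y 1, y 2, y 3] := rfl

lemma sixProj_apply (x : Fin 8 → F) : sixProj x = ![x 0, x 5, x 6, x 7, x 2, x 1] := rfl

lemma sixProj_sixLift (y : Fin 6 → F) : sixProj (sixLift y) = y := by
  ext i; fin_cases i <;> rfl

lemma sixProj_octOne : sixProj (octOne : Fin 8 → F) = 0 := by
  ext i; fin_cases i <;> rfl

lemma sixLift_mem (y : Fin 6 → F) : sixLift y ∈ octPerp F := by
  change octForm _ _ = 0
  rw [octForm_octOne]
  simp [sixLift_apply]

lemma mem_octPerp_iff [CharP F 2] (x : Fin 8 → F) : x ∈ octPerp F ↔ x 3 = x 4 := by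
  change octForm _ _ = 0 ↔ _
  rw [octForm_octOne, CharTwo.add_eq_zero]

lemma sixLift_sixProj [CharP F 2] {x : Fin 8 → F} (hx : x ∈ octPerp F) :
    sixLift (sixProj x) = x - x 3 • octOne := by
  rw [mem_octPerp_iff] at hx
  ext i; fin_cases i <;> simp [sixLift_apply, sixProj_apply, octOne, hx]

/-- The symplectic form that `octForm` induces on `e^⊥ / ⟨e⟩`. -/
def sixForm (x y : Fin 6 → F) : F :=
  x 0 * y 3 + x 1 * y 4 + x 2 * y 5 + x 3 * y 0 + x 4 * y 1 + x 5 * y 2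

lemma octForm_eq_sixForm [CharP F 2] {x y : Fin 8 → F} (hx : x ∈ octPerp F)
    (hy : y ∈ octPerp F) : octForm x y = sixForm (sixProj x) (sixProj y) := by
  have h2 : (2 : F) = 0 := CharTwo.two_eq_zero
  rw [mem_octPerp_iff] at hx hy
  simp [octForm, sixForm, sixProj_apply, Fin.sum_univ_eight, Fin.rev]
  grind

/-- This recovers the form from the product, which is why automorphisms preserve it. -/
lemma octMul_add_octMul [CharP F 2] {x y : Fin 8 → F} (hx : x ∈ octPerp F)
    (hy : y ∈ octPerp F) : octMul x y + octMul y x = octForm x y • octOne := by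
  have h2 : (2 : F) = 0 := CharTwo.two_eq_zero
  rw [mem_octPerp_iff] at hx hy
  ext i
  fin_cases i <;> simp [octForm, octMul, octOne, Fin.sum_univ_eight, Fin.rev] <;> grind

lemma octForm_octAut [CharP F 2] {g : (Fin 8 → F) ≃ₗ[F] (Fin 8 → F)} (hg : g ∈ octAut F)
    {x y : Fin 8 → F} (hx : x ∈ octPerp F) (hy : y ∈ octPerp F) :
    octForm (g x) (g y) = octForm x y := by
  have h := octMul_add_octMul (octAut_mem_octPerp hg hx) (octAut_mem_octPerp hg hy)
  rw [← hg, ← hg, ← map_add, octMul_add_octMul hx hy, map_smul, octAut_octOne hg] at h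
  simpa [octOne] using (congrFun h 3).symm

/-! ### Explicit root elements of `G₂(q)` -/

/-- The short root elements for the Peirce space of `x₄`. -/
def octShear (a₁ a₂ a₃ : F) : (Fin 8 → F) →ₗ[F] (Fin 8 → F) where
  toFun x := ![
    x 0 + (x 3 + x 4 + (a₁ * x 7 + a₂ * x 2 + a₃ * x 1)) * a₁,
    x 1 + (a₁ * x 5 + a₂ * x 0),
    x 2 + (a₃ * x 0 + a₁ * x 6),
    x 3 + (a₁ * x 7 + a₂ * x 2 + a₃ * x 1),
    x 4 + (a₁ * x 7 + a₂ * x 2 + a₃ * x 1),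
    x 5 + (x 3 + x 4 + (a₁ * x 7 + a₂ * x 2 + a₃ * x 1)) * a₂,
    x 6 + (x 3 + x 4 + (a₁ * x 7 + a₂ * x 2 + a₃ * x 1)) * a₃,
    x 7 + (a₂ * x 6 + a₃ * x 5)]
  map_add' x y := by ext i; fin_cases i <;> simp <;> ring
  map_smul' c x := by ext i; fin_cases i <;> simp <;> ring

lemma octShear_apply (a₁ a₂ a₃ : F) (x : Fin 8 → F) : octShear a₁ a₂ a₃ x = ![
    x 0 + (x 3 + x 4 + (a₁ * x 7 + a₂ * x 2 + a₃ * x 1)) * a₁,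
    x 1 + (a₁ * x 5 + a₂ * x 0),
    x 2 + (a₃ * x 0 + a₁ * x 6),
    x 3 + (a₁ * x 7 + a₂ * x 2 + a₃ * x 1),
    x 4 + (a₁ * x 7 + a₂ * x 2 + a₃ * x 1),
    x 5 + (x 3 + x 4 + (a₁ * x 7 + a₂ * x 2 + a₃ * x 1)) * a₂,
    x 6 + (x 3 + x 4 + (a₁ * x 7 + a₂ * x 2 + a₃ * x 1)) * a₃,
    x 7 + (a₂ * x 6 + a₃ * x 5)] := rfl

/-- The short root elements for the Peirce space of `x₅`. -/
def octShear' (b₁ b₂ b₃ : F) : (Fin 8 → F) →ₗ[F] (Fin 8 → F) where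
  toFun x := ![
    x 0 + (b₂ * x 1 + b₃ * x 2),
    x 1 + (x 3 + x 4 + (b₁ * x 0 + b₂ * x 5 + b₃ * x 6)) * b₃,
    x 2 + (x 3 + x 4 + (b₁ * x 0 + b₂ * x 5 + b₃ * x 6)) * b₂,
    x 3 + (b₁ * x 0 + b₂ * x 5 + b₃ * x 6),
    x 4 + (b₁ * x 0 + b₂ * x 5 + b₃ * x 6),
    x 5 + (b₃ * x 7 + b₁ * x 1),
    x 6 + (b₁ * x 2 + b₂ * x 7),
    x 7 + (x 3 + x 4 + (b₁ * x 0 + b₂ * x 5 + b₃ * x 6)) * b₁]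
  map_add' x y := by ext i; fin_cases i <;> simp <;> ring
  map_smul' c x := by ext i; fin_cases i <;> simp <;> ring

lemma octShear'_apply (b₁ b₂ b₃ : F) (x : Fin 8 → F) : octShear' b₁ b₂ b₃ x = ![
    x 0 + (b₂ * x 1 + b₃ * x 2),
    x 1 + (x 3 + x 4 + (b₁ * x 0 + b₂ * x 5 + b₃ * x 6)) * b₃,
    x 2 + (x 3 + x 4 + (b₁ * x 0 + b₂ * x 5 + b₃ * x 6)) * b₂,
    x 3 + (b₁ * x 0 + b₂ * x 5 + b₃ * x 6),
    x 4 + (b₁ * x 0 + b₂ * x 5 + b₃ * x 6),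
    x 5 + (b₃ * x 7 + b₁ * x 1),
    x 6 + (b₁ * x 2 + b₂ * x 7),
    x 7 + (x 3 + x 4 + (b₁ * x 0 + b₂ * x 5 + b₃ * x 6)) * b₁] := rfl

/-- The long root elements in the subgroup `SL₃` that fixes `x₄` and `x₅`. -/
def octTransvection (w₁ w₂ w₃ s₁ s₂ s₃ : F) : (Fin 8 → F) →ₗ[F] (Fin 8 → F) where
  toFun x := ![
    x 0 + ((w₂ * s₃ + w₃ * s₂) * x 0 + (w₃ * s₁ + w₁ * s₃) * x 5 + (w₁ * s₂ + w₂ * s₁) * x 6) * w₁,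
    x 1 + (w₁ * x 7 + w₂ * x 2 + w₃ * x 1) * (w₁ * s₂ + w₂ * s₁),
    x 2 + (w₁ * x 7 + w₂ * x 2 + w₃ * x 1) * (w₃ * s₁ + w₁ * s₃),
    x 3, x 4,
    x 5 + ((w₂ * s₃ + w₃ * s₂) * x 0 + (w₃ * s₁ + w₁ * s₃) * x 5 + (w₁ * s₂ + w₂ * s₁) * x 6) * w₂,
    x 6 + ((w₂ * s₃ + w₃ * s₂) * x 0 + (w₃ * s₁ + w₁ * s₃) * x 5 + (w₁ * s₂ + w₂ * s₁) * x 6) * w₃,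
    x 7 + (w₁ * x 7 + w₂ * x 2 + w₃ * x 1) * (w₂ * s₃ + w₃ * s₂)]
  map_add' x y := by ext i; fin_cases i <;> simp <;> ring
  map_smul' c x := by ext i; fin_cases i <;> simp <;> ring

lemma octTransvection_apply (w₁ w₂ w₃ s₁ s₂ s₃ : F) (x : Fin 8 → F) : octTransvection w₁ w₂ w₃ s₁ s₂ s₃ x = ![
    x 0 + ((w₂ * s₃ + w₃ * s₂) * x 0 + (w₃ * s₁ + w₁ * s₃) * x 5 + (w₁ * s₂ + w₂ * s₁) * x 6) * w₁,
    x 1 + (w₁ * x 7 + w₂ * x 2 + w₃ * x 1) * (w₁ * s₂ + w₂ * s₁),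
    x 2 + (w₁ * x 7 + w₂ * x 2 + w₃ * x 1) * (w₃ * s₁ + w₁ * s₃),
    x 3, x 4,
    x 5 + ((w₂ * s₃ + w₃ * s₂) * x 0 + (w₃ * s₁ + w₁ * s₃) * x 5 + (w₁ * s₂ + w₂ * s₁) * x 6) * w₂,
    x 6 + ((w₂ * s₃ + w₃ * s₂) * x 0 + (w₃ * s₁ + w₁ * s₃) * x 5 + (w₁ * s₂ + w₂ * s₁) * x 6) * w₃,
    x 7 + (w₁ * x 7 + w₂ * x 2 + w₃ * x 1) * (w₂ * s₃ + w₃ * s₂)] := rfl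

variable [CharP F 2]

lemma sixProj_octAut_congr {g : (Fin 8 → F) ≃ₗ[F] (Fin 8 → F)} (hg : g ∈ octAut F)
    {x : Fin 8 → F} (hx : x ∈ octPerp F) : sixProj (g (sixLift (sixProj x))) = sixProj (g x) := by
  rw [sixLift_sixProj hx, map_sub, map_smul, octAut_octOne hg, map_sub, map_smul, sixProj_octOne,
    smul_zero, sub_zero]

variable (F) in
/-- The permutations of `F⁶` that are induced by the automorphisms of the octonion algebra. -/
def sixGroup : Subgroup (Equiv.Perm (Fin 6 → F)) where
  carrier := {p | ∃ g ∈ octAut F, ∀ y, p y = sixProj (g (sixLift y))}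
  one_mem' := ⟨1, one_mem _, fun y => (sixProj_sixLift y).symm⟩
  mul_mem' := by
    rintro p r ⟨g, hg, hp⟩ ⟨k, hk, hr⟩
    refine ⟨g * k, mul_mem hg hk, fun y => ?_⟩
    rw [Equiv.Perm.mul_apply, hp, hr,
      sixProj_octAut_congr hg (octAut_mem_octPerp hk (sixLift_mem y)), LinearEquiv.mul_apply]
  inv_mem' := by
    rintro p ⟨g, hg, hp⟩
    refine ⟨g⁻¹, inv_mem hg, fun y => ?_⟩
    rw [Equiv.Perm.inv_eq_iff_eq, hp,
      sixProj_octAut_congr hg (octAut_mem_octPerp (inv_mem hg) (sixLift_mem y))]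
    exact (sixProj_sixLift y).symm.trans (congrArg sixProj (g.apply_symm_apply _).symm)

lemma exists_mem_sixGroup {g : (Fin 8 → F) ≃ₗ[F] (Fin 8 → F)} (hg : g ∈ octAut F) :
    ∃ p ∈ sixGroup F, ∀ y, p y = sixProj (g (sixLift y)) := by
  have key : ∀ {k k' : (Fin 8 → F) ≃ₗ[F] (Fin 8 → F)}, k ∈ octAut F → k' ∈ octAut F →
      k * k' = 1 → ∀ y, sixProj (k (sixLift (sixProj (k' (sixLift y))))) = y := by
    intro k k' hk hk' h y
    rw [sixProj_octAut_congr hk (octAut_mem_octPerp hk' (sixLift_mem y)),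
      ← LinearEquiv.mul_apply, h]
    exact sixProj_sixLift y
  exact ⟨⟨fun y => sixProj (g (sixLift y)), fun y => sixProj (g⁻¹ (sixLift y)),
    key (inv_mem hg) hg (inv_mul_cancel g), key hg (inv_mem hg) (mul_inv_cancel g)⟩,
    ⟨g, hg, fun _ => rfl⟩, fun _ => rfl⟩

lemma sixGroup_smul {p : Equiv.Perm (Fin 6 → F)} (hp : p ∈ sixGroup F) (a : F)
    (y : Fin 6 → F) : p (a • y) = a • p y := by
  obtain ⟨g, hg, h⟩ := hp
  simp [h]

lemma sixForm_sixGroup {p : Equiv.Perm (Fin 6 → F)} (hp : p ∈ sixGroup F)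
    (x y : Fin 6 → F) : sixForm (p x) (p y) = sixForm x y := by
  obtain ⟨g, hg, h⟩ := hp
  rw [h, h, ← octForm_eq_sixForm (octAut_mem_octPerp hg (sixLift_mem x))
    (octAut_mem_octPerp hg (sixLift_mem y)), octForm_octAut hg (sixLift_mem x) (sixLift_mem y),
    octForm_eq_sixForm (sixLift_mem x) (sixLift_mem y), sixProj_sixLift, sixProj_sixLift]

/-- Involutivity supplies the inverse, so for a root element given as a linear map only
multiplicativity remains. -/
lemma exists_sixGroup_of_involutive (k : (Fin 8 → F) →ₗ[F] (Fin 8 → F))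
    (hk : Function.Involutive k) (hmul : ∀ x y, k (octMul x y) = octMul (k x) (k y)) :
    ∃ p ∈ sixGroup F, ∀ y, p y = sixProj (k (sixLift y)) :=
  exists_mem_sixGroup (g := LinearEquiv.ofInvolutive k hk) hmul

lemma octShear_involutive (a₁ a₂ a₃ : F) : Function.Involutive (octShear a₁ a₂ a₃) := by
  intro x
  have h2 : (2 : F) = 0 := CharTwo.two_eq_zero
  have h4 : (4 : F) = 0 := by grind
  ext i
  -- With both sides moved into one sum, `ring_nf` leaves only even coefficients, which vanish.
  rw [← CharTwo.add_eq_zero]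
  fin_cases i <;> simp [octShear_apply] <;> ring_nf <;> simp only [h2, h4, mul_zero, add_zero]

lemma octShear_octMul (a₁ a₂ a₃ : F) (x y : Fin 8 → F) :
    octShear a₁ a₂ a₃ (octMul x y) = octMul (octShear a₁ a₂ a₃ x) (octShear a₁ a₂ a₃ y) := by
  have h2 : (2 : F) = 0 := CharTwo.two_eq_zero
  ext i
  rw [← CharTwo.add_eq_zero, octMul, octMul, octShear_apply, octShear_apply, octShear_apply]
  fin_cases i <;> simp <;> ring_nf <;> simp only [h2, mul_zero, add_zero]

/-- The short root elements for the Peirce space of `x₄`. -/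
lemma exists_sixGroup_shear (a₁ a₂ a₃ : F) : ∃ p ∈ sixGroup F, ∀ u₁ u₂ u₃ v₁ v₂ v₃ : F,
    p ![u₁, u₂, u₃, v₁, v₂, v₃] =
      ![u₁ + (a₁ * v₁ + a₂ * v₂ + a₃ * v₃) * a₁, u₂ + (a₁ * v₁ + a₂ * v₂ + a₃ * v₃) * a₂,
        u₃ + (a₁ * v₁ + a₂ * v₂ + a₃ * v₃) * a₃, v₁ + (a₂ * u₃ + a₃ * u₂),
        v₂ + (a₃ * u₁ + a₁ * u₃), v₃ + (a₁ * u₂ + a₂ * u₁)] := by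
  obtain ⟨p, hp, h⟩ := exists_sixGroup_of_involutive (octShear a₁ a₂ a₃)
    (octShear_involutive a₁ a₂ a₃) (octShear_octMul a₁ a₂ a₃)
  refine ⟨p, hp, fun u₁ u₂ u₃ v₁ v₂ v₃ => ?_⟩
  rw [h]
  ext i
  fin_cases i <;> simp [sixProj_apply, sixLift_apply, octShear_apply]

lemma octShear'_involutive (b₁ b₂ b₃ : F) : Function.Involutive (octShear' b₁ b₂ b₃) := by
  intro x
  have h2 : (2 : F) = 0 := CharTwo.two_eq_zero
  have h4 : (4 : F) = 0 := by grind
  ext i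
  rw [← CharTwo.add_eq_zero]
  fin_cases i <;> simp [octShear'_apply] <;> ring_nf <;> simp only [h2, h4, mul_zero, add_zero]

lemma octShear'_octMul (b₁ b₂ b₃ : F) (x y : Fin 8 → F) :
    octShear' b₁ b₂ b₃ (octMul x y) = octMul (octShear' b₁ b₂ b₃ x) (octShear' b₁ b₂ b₃ y) := by
  have h2 : (2 : F) = 0 := CharTwo.two_eq_zero
  ext i
  rw [← CharTwo.add_eq_zero, octMul, octMul, octShear'_apply, octShear'_apply, octShear'_apply]
  fin_cases i <;> simp <;> ring_nf <;> simp only [h2, mul_zero, add_zero]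

/-- The short root elements for the Peirce space of `x₅`. -/
lemma exists_sixGroup_shear' (b₁ b₂ b₃ : F) : ∃ p ∈ sixGroup F, ∀ u₁ u₂ u₃ v₁ v₂ v₃ : F,
    p ![u₁, u₂, u₃, v₁, v₂, v₃] =
      ![u₁ + (b₂ * v₃ + b₃ * v₂), u₂ + (b₃ * v₁ + b₁ * v₃), u₃ + (b₁ * v₂ + b₂ * v₁),
        v₁ + (b₁ * u₁ + b₂ * u₂ + b₃ * u₃) * b₁, v₂ + (b₁ * u₁ + b₂ * u₂ + b₃ * u₃) * b₂,
        v₃ + (b₁ * u₁ + b₂ * u₂ + b₃ * u₃) * b₃] := by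
  obtain ⟨p, hp, h⟩ := exists_sixGroup_of_involutive (octShear' b₁ b₂ b₃)
    (octShear'_involutive b₁ b₂ b₃) (octShear'_octMul b₁ b₂ b₃)
  refine ⟨p, hp, fun u₁ u₂ u₃ v₁ v₂ v₃ => ?_⟩
  rw [h]
  ext i
  fin_cases i <;> simp [sixProj_apply, sixLift_apply, octShear'_apply]

lemma octTransvection_involutive (w₁ w₂ w₃ s₁ s₂ s₃ : F) : Function.Involutive (octTransvection w₁ w₂ w₃ s₁ s₂ s₃) := by
  intro x
  have h2 : (2 : F) = 0 := CharTwo.two_eq_zero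
  have h4 : (4 : F) = 0 := by grind
  ext i
  rw [← CharTwo.add_eq_zero]
  fin_cases i <;> simp [octTransvection_apply] <;> ring_nf <;> simp only [h2, h4, mul_zero, add_zero]

lemma octTransvection_octMul (w₁ w₂ w₃ s₁ s₂ s₃ : F) (x y : Fin 8 → F) :
    octTransvection w₁ w₂ w₃ s₁ s₂ s₃ (octMul x y) = octMul (octTransvection w₁ w₂ w₃ s₁ s₂ s₃ x) (octTransvection w₁ w₂ w₃ s₁ s₂ s₃ y) := by
  have h2 : (2 : F) = 0 := CharTwo.two_eq_zero
  have h4 : (4 : F) = 0 := by grind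
  ext i
  rw [← CharTwo.add_eq_zero, octMul, octMul, octTransvection_apply, octTransvection_apply, octTransvection_apply]
  fin_cases i <;> simp <;> ring_nf <;> simp only [h2, h4, mul_zero, add_zero]

/-- The long root elements in the subgroup `SL₃` that fixes `x₄` and `x₅`; here `r` is the cross product of
`w` and `s`. -/
lemma exists_sixGroup_transvection (w₁ w₂ w₃ s₁ s₂ s₃ r₁ r₂ r₃ : F)
    (h₁ : r₁ = w₂ * s₃ + w₃ * s₂) (h₂ : r₂ = w₃ * s₁ + w₁ * s₃) (h₃ : r₃ = w₁ * s₂ + w₂ * s₁) :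
    ∃ p ∈ sixGroup F, ∀ u₁ u₂ u₃ v₁ v₂ v₃ : F, p ![u₁, u₂, u₃, v₁, v₂, v₃] =
      ![u₁ + (r₁ * u₁ + r₂ * u₂ + r₃ * u₃) * w₁, u₂ + (r₁ * u₁ + r₂ * u₂ + r₃ * u₃) * w₂,
        u₃ + (r₁ * u₁ + r₂ * u₂ + r₃ * u₃) * w₃, v₁ + (w₁ * v₁ + w₂ * v₂ + w₃ * v₃) * r₁,
        v₂ + (w₁ * v₁ + w₂ * v₂ + w₃ * v₃) * r₂, v₃ + (w₁ * v₁ + w₂ * v₂ + w₃ * v₃) * r₃] := by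
  subst h₁ h₂ h₃
  obtain ⟨p, hp, h⟩ := exists_sixGroup_of_involutive (octTransvection w₁ w₂ w₃ s₁ s₂ s₃)
    (octTransvection_involutive w₁ w₂ w₃ s₁ s₂ s₃) (octTransvection_octMul w₁ w₂ w₃ s₁ s₂ s₃)
  refine ⟨p, hp, fun u₁ u₂ u₃ v₁ v₂ v₃ => ?_⟩
  rw [h]
  ext i
  fin_cases i <;> simp [sixProj_apply, sixLift_apply, octTransvection_apply]
end SixDimensional

/-! ### Transitivity on vectors and on non-orthogonal pairs -/

section SixTransitivity
variable {F : Type*} [Field F]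

variable (F) in
/-- The first vector of the standard basis of `F⁶`. -/
def sixBase : Fin 6 → F := ![1, 0, 0, 0, 0, 0]

lemma exists_eq_vec_six {F : Type*} (x : Fin 6 → F) :
    ∃ u₁ u₂ u₃ v₁ v₂ v₃ : F, x = ![u₁, u₂, u₃, v₁, v₂, v₃] :=
  ⟨x 0, x 1, x 2, x 3, x 4, x 5, by ext i; fin_cases i <;> rfl⟩

lemma sixForm_zero_left (y : Fin 6 → F) : sixForm 0 y = 0 := by simp [sixForm]

lemma exists_sixForm_ne_zero {x : Fin 6 → F} (hx : x ≠ 0) : ∃ z, sixForm x z ≠ 0 := by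
  by_contra! h
  apply hx
  have h3 := h ![0, 0, 0, 1, 0, 0]
  have h4 := h ![0, 0, 0, 0, 1, 0]
  have h5 := h ![0, 0, 0, 0, 0, 1]
  have h0 := h ![1, 0, 0, 0, 0, 0]
  have h1 := h ![0, 1, 0, 0, 0, 0]
  have h2 := h ![0, 0, 1, 0, 0, 0]
  simp [sixForm] at h0 h1 h2 h3 h4 h5
  ext i
  fin_cases i <;> assumption

lemma sixForm_add_right (x y z : Fin 6 → F) : sixForm x (y + z) = sixForm x y + sixForm x z := by
  simp only [sixForm, Pi.add_apply]; ring

lemma sixForm_smul_right (a : F) (x y : Fin 6 → F) : sixForm x (a • y) = a * sixForm x y := by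
  simp only [sixForm, Pi.smul_apply, smul_eq_mul]; ring

/-- Two hyperplanes do not cover the space: if neither witness avoids both, their sum does. -/
lemma exists_sixForm_ne_zero_two {x y : Fin 6 → F} (hx : x ≠ 0) (hy : y ≠ 0) :
    ∃ z, sixForm x z ≠ 0 ∧ sixForm y z ≠ 0 := by
  obtain ⟨z, hz⟩ := exists_sixForm_ne_zero hx
  obtain ⟨z', hz'⟩ := exists_sixForm_ne_zero hy
  by_cases h : sixForm y z = 0
  · by_cases h' : sixForm x z' = 0
    · exact ⟨z + z', by simpa [sixForm_add_right, h'], by simpa [sixForm_add_right, h]⟩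
    · exact ⟨z', h', hz'⟩
  · exact ⟨z, hz, h⟩

variable [CharP F 2]

/-- Two pairs of vectors are equivalent if an element of `sixGroup` maps one to the other. -/
def SixPairRel (x y x' y' : Fin 6 → F) : Prop := ∃ p ∈ sixGroup F, p x = x' ∧ p y = y'

lemma SixPairRel.symm {x y x' y' : Fin 6 → F} (h : SixPairRel x y x' y') :
    SixPairRel x' y' x y := by
  obtain ⟨p, hp, rfl, rfl⟩ := h
  exact ⟨p⁻¹, inv_mem hp, by simp, by simp⟩

lemma SixPairRel.trans {x y x' y' x'' y'' : Fin 6 → F} (h : SixPairRel x y x' y')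
    (h' : SixPairRel x' y' x'' y'') : SixPairRel x y x'' y'' := by
  obtain ⟨p, hp, rfl, rfl⟩ := h
  obtain ⟨r, hr, rfl, rfl⟩ := h'
  exact ⟨r * p, mul_mem hr hp, rfl, rfl⟩

/-- Two vectors are equivalent if they are in the same orbit of `sixGroup`. -/
def SixRel (x y : Fin 6 → F) : Prop := ∃ p ∈ sixGroup F, p x = y

lemma SixRel.symm {x y : Fin 6 → F} (h : SixRel x y) : SixRel y x := by
  obtain ⟨p, hp, rfl⟩ := h
  exact ⟨p⁻¹, inv_mem hp, by simp⟩

lemma SixRel.trans {x y z : Fin 6 → F} (h : SixRel x y) (h' : SixRel y z) : SixRel x z := by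
  obtain ⟨p, hp, rfl⟩ := h
  obtain ⟨r, hr, rfl⟩ := h'
  exact ⟨r * p, mul_mem hr hp, rfl⟩

lemma sixRel_sixBase_of_ne {u₁ u₂ u₃ : F} (h : u₂ ≠ 0 ∨ u₃ ≠ 0) :
    SixRel ![u₁, u₂, u₃, 0, 0, 0] (sixBase F) := by
  have h2 : (2 : F) = 0 := CharTwo.two_eq_zero
  obtain ⟨s₂, s₃, hs⟩ : ∃ s₂ s₃, s₂ * u₃ + s₃ * u₂ = 1 := by
    by_cases h3 : u₃ = 0
    · exact ⟨0, u₂⁻¹, by simp_all⟩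
    · exact ⟨u₃⁻¹, 0, by simp_all⟩
  -- Here `w = u + e₁`. As `r` is orthogonal to `w`, `r·u = r·e₁ = r₁ = 1`, so the transvection adds
  -- `w` to `u` and gives `e₁`.
  obtain ⟨p, hp, hp'⟩ := exists_sixGroup_transvection (u₁ + 1) u₂ u₃ 0 s₂ s₃ _ _ _ rfl rfl rfl
  refine ⟨p, hp, ?_⟩
  rw [hp', sixBase]
  ext i
  fin_cases i <;> simp <;> grind

lemma sixRel_sixBase_of_zero {u₁ u₂ u₃ : F} (h : u₁ ≠ 0 ∨ u₂ ≠ 0 ∨ u₃ ≠ 0) :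
    SixRel ![u₁, u₂, u₃, 0, 0, 0] (sixBase F) := by
  by_cases h' : u₂ ≠ 0 ∨ u₃ ≠ 0
  · exact sixRel_sixBase_of_ne h'
  · obtain ⟨rfl, rfl⟩ : u₂ = 0 ∧ u₃ = 0 := by simpa using h'
    -- This transvection has `r₁ = u₁⁻¹` and makes the second coordinate 1, reducing to the previous
    -- lemma.
    obtain ⟨p, hp, hp'⟩ := exists_sixGroup_transvection 0 1 0 0 0 u₁⁻¹ _ _ _ rfl rfl rfl
    refine SixRel.trans ⟨p, hp, hp' _ _ _ _ _ _⟩ ?_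
    have := sixRel_sixBase_of_ne (u₁ := u₁) (u₂ := 1) (u₃ := 0) (by simp)
    convert this using 2 <;> simp_all

/-- Since `u ≠ 0` and `u·v = 0`, `v` is a cross product `a × u`. The shear by `a` then clears `v`,
and it leaves `u` unchanged because `a·v = 0`. -/
lemma sixRel_sixBase_of_orthogonal {u₁ u₂ u₃ v₁ v₂ v₃ : F} (h : u₁ ≠ 0 ∨ u₂ ≠ 0 ∨ u₃ ≠ 0)
    (huv : u₁ * v₁ + u₂ * v₂ + u₃ * v₃ = 0) :
    SixRel ![u₁, u₂, u₃, v₁, v₂, v₃] (sixBase F) := by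
  have h2 : (2 : F) = 0 := CharTwo.two_eq_zero
  obtain ⟨a₁, a₂, a₃, h₁, h₂, h₃⟩ : ∃ a₁ a₂ a₃ : F, a₂ * u₃ + a₃ * u₂ = v₁ ∧
      a₃ * u₁ + a₁ * u₃ = v₂ ∧ a₁ * u₂ + a₂ * u₁ = v₃ := by
    rcases h with h | h | h
    · exact ⟨0, v₃ / u₁, v₂ / u₁, by field_simp; grind, by field_simp; grind, by field_simp; grind⟩
    · exact ⟨v₃ / u₂, 0, v₁ / u₂, by field_simp; grind, by field_simp; grind, by field_simp; grind⟩
    · exact ⟨v₂ / u₃, v₁ / u₃, 0, by field_simp; grind, by field_simp; grind, by field_simp; grind⟩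
  have h0 : a₁ * v₁ + a₂ * v₂ + a₃ * v₃ = 0 := by subst h₁ h₂ h₃; grind
  obtain ⟨p, hp, hp'⟩ := exists_sixGroup_shear a₁ a₂ a₃
  refine SixRel.trans ⟨p, hp, hp' _ _ _ _ _ _⟩ ?_
  simp only [h0, h₁, h₂, h₃, CharTwo.add_self_eq_zero, zero_mul, add_zero]
  exact sixRel_sixBase_of_zero h

lemma exists_sq_eq [Finite F] (c : F) : ∃ t : F, t * t = c := by
  obtain ⟨t, ht⟩ := surjective_frobenius F 2 c
  exact ⟨t, by rw [← ht, frobenius_def, pow_two]⟩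

/-- Take `t² = u·v` and `b` with `b·u = t`. The shear by `b` replaces `u` by `u + b × v` and `v` by
`v + t b` (up to the order of coordinates used in `octShear'`, already undone here), whose product
is `u·v + t² = 0`. The new `u` is nonzero, for `u = b × v` would give `u·v = 0`. -/
lemma sixRel_sixBase_of_left [Finite F] {u₁ u₂ u₃ v₁ v₂ v₃ : F}
    (h : u₁ ≠ 0 ∨ u₂ ≠ 0 ∨ u₃ ≠ 0) : SixRel ![u₁, u₂, u₃, v₁, v₂, v₃] (sixBase F) := by
  have h2 : (2 : F) = 0 := CharTwo.two_eq_zero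
  by_cases huv : u₁ * v₁ + u₂ * v₂ + u₃ * v₃ = 0
  · exact sixRel_sixBase_of_orthogonal h huv
  obtain ⟨t, ht⟩ := exists_sq_eq (u₁ * v₁ + u₂ * v₂ + u₃ * v₃)
  obtain ⟨b₁, b₂, b₃, hb⟩ : ∃ b₁ b₂ b₃ : F, b₁ * u₁ + b₂ * u₂ + b₃ * u₃ = t := by
    rcases h with h | h | h
    · exact ⟨t / u₁, 0, 0, by field_simp; simp⟩
    · exact ⟨0, t / u₂, 0, by field_simp; simp⟩
    · exact ⟨0, 0, t / u₃, by field_simp; simp⟩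
  obtain ⟨p, hp, hp'⟩ := exists_sixGroup_shear' b₁ b₂ b₃
  refine SixRel.trans ⟨p, hp, hp' _ _ _ _ _ _⟩ (sixRel_sixBase_of_orthogonal ?_ ?_)
  · by_contra! hc
    obtain ⟨h₁, h₂, h₃⟩ := hc
    apply huv
    linear_combination v₁ * h₁ + v₂ * h₂ + v₃ * h₃
      - (b₁ * v₂ * v₃ + b₂ * v₁ * v₃ + b₃ * v₁ * v₂) * h2
  · rw [hb]
    linear_combination (-1 : F) * ht + t * hb + (t * t +
      b₁ * v₂ * v₃ + b₂ * v₁ * v₃ + b₃ * v₁ * v₂ +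
      t * (b₁ * b₂ * v₃ + b₂ * b₃ * v₁ + b₃ * b₁ * v₂)) * h2

lemma sixRel_sixBase [Finite F] {x : Fin 6 → F} (hx : x ≠ 0) : SixRel x (sixBase F) := by
  obtain ⟨u₁, u₂, u₃, v₁, v₂, v₃, rfl⟩ := exists_eq_vec_six x
  by_cases h : u₁ ≠ 0 ∨ u₂ ≠ 0 ∨ u₃ ≠ 0
  · exact sixRel_sixBase_of_left h
  obtain ⟨rfl, rfl, rfl⟩ : u₁ = 0 ∧ u₂ = 0 ∧ u₃ = 0 := by simpa using h
  obtain ⟨a₁, a₂, a₃, ha, ha'⟩ : ∃ a₁ a₂ a₃ : F, (a₁ ≠ 0 ∨ a₂ ≠ 0 ∨ a₃ ≠ 0) ∧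
      a₁ * v₁ + a₂ * v₂ + a₃ * v₃ = 1 := by
    by_cases h₁ : v₁ = 0
    · by_cases h₂ : v₂ = 0
      · have h₃ : v₃ ≠ 0 := by
          rintro rfl
          apply hx
          subst h₁ h₂
          ext i; fin_cases i <;> rfl
        exact ⟨0, 0, v₃⁻¹, by simp [h₃], by simp [h₃]⟩
      · exact ⟨0, v₂⁻¹, 0, by simp [h₂], by simp [h₂]⟩
    · exact ⟨v₁⁻¹, 0, 0, by simp [h₁], by simp [h₁]⟩
  -- With `u = 0` and `a·v = 1`, the new `u` is `a`, which is nonzero.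
  obtain ⟨p, hp, hp'⟩ := exists_sixGroup_shear a₁ a₂ a₃
  refine SixRel.trans ⟨p, hp, hp' _ _ _ _ _ _⟩ (sixRel_sixBase_of_left ?_)
  simpa [ha'] using ha

lemma sixRel_of_ne_zero [Finite F] {x y : Fin 6 → F} (hx : x ≠ 0) (hy : y ≠ 0) : SixRel x y :=
  (sixRel_sixBase hx).trans (sixRel_sixBase hy).symm

/-- Elements fixing `sixBase` clear first `u₂, u₃`, then `v₂, v₃`, and finally `u₁`; the last one
needs a square root of `u₁ / v₁`. -/
lemma sixPairRel_sixBase [Finite F] {c : F} (hc : c ≠ 0) {y : Fin 6 → F}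
    (hy : sixForm (sixBase F) y = c) :
    SixPairRel (sixBase F) y (sixBase F) ![0, 0, 0, c, 0, 0] := by
  have h2 : (2 : F) = 0 := CharTwo.two_eq_zero
  obtain ⟨u₁, u₂, u₃, v₁, v₂, v₃, rfl⟩ := exists_eq_vec_six y
  obtain rfl : v₁ = c := by simpa [sixForm, sixBase] using hy
  have step₁ : ∃ u v v' : F, SixPairRel (sixBase F) ![u₁, u₂, u₃, v₁, v₂, v₃] (sixBase F)
      ![u, 0, 0, v₁, v, v'] := by
    obtain ⟨p, hp, hp'⟩ := exists_sixGroup_shear' 0 (u₃ / v₁) (u₂ / v₁)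
    have h := hp' u₁ u₂ u₃ v₁ v₂ v₃
    simp only [zero_mul, add_zero, mul_zero, zero_add, div_mul_cancel₀ _ hc,
      CharTwo.add_self_eq_zero] at h
    exact ⟨_, _, _, p, hp, by rw [sixBase, hp']; simp, h⟩
  have step₂ : ∀ u v v' : F, SixPairRel (sixBase F) ![u, 0, 0, v₁, v, v'] (sixBase F)
      ![u, 0, 0, v₁, 0, 0] := by
    intro u v v'
    obtain ⟨p, hp, hp'⟩ := exists_sixGroup_transvection 1 0 0 0 (v' / v₁) (v / v₁)
      _ _ _ rfl rfl rfl
    refine ⟨p, hp, ?_, ?_⟩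
    · rw [sixBase, hp']; simp
    · rw [hp']; simp [mul_div_cancel₀ _ hc, CharTwo.add_self_eq_zero]
  have step₃ : ∀ u : F, SixPairRel (sixBase F) ![u, 0, 0, v₁, 0, 0] (sixBase F)
      ![0, 0, 0, v₁, 0, 0] := by
    intro u
    obtain ⟨t, ht⟩ := exists_sq_eq (u / v₁)
    obtain ⟨p, hp, hp'⟩ := exists_sixGroup_shear t 0 0
    refine ⟨p, hp, ?_, ?_⟩
    · rw [sixBase, hp']; simp
    · have : u + t * v₁ * t = 0 := by
        rw [mul_right_comm, ht, div_mul_cancel₀ _ hc, CharTwo.add_self_eq_zero]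
      rw [hp']; simp [this]
  obtain ⟨u, v, v', h⟩ := step₁
  exact (h.trans (step₂ u v v')).trans (step₃ u)

lemma sixPairRel_of_sixForm_eq [Finite F] {x y x' y' : Fin 6 → F} (h0 : sixForm x y ≠ 0)
    (h : sixForm x y = sixForm x' y') : SixPairRel x y x' y' := by
  have key : ∀ {x y : Fin 6 → F}, sixForm x y ≠ 0 →
      SixPairRel x y (sixBase F) ![0, 0, 0, sixForm x y, 0, 0] := by
    intro x y h0
    obtain ⟨p, hp, hx⟩ := sixRel_sixBase (x := x) (by rintro rfl; exact h0 (sixForm_zero_left y))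
    refine SixPairRel.trans ⟨p, hp, hx, rfl⟩ (sixPairRel_sixBase h0 ?_)
    rw [← hx, sixForm_sixGroup hp]
  have h1 := key h0
  rw [h] at h0 h1
  exact h1.trans (key h0).symm

lemma sixForm_self (x : Fin 6 → F) : sixForm x x = 0 := by
  have h2 : (2 : F) = 0 := CharTwo.two_eq_zero
  simp only [sixForm]; linear_combination (x 0 * x 3 + x 1 * x 4 + x 2 * x 5) * h2

/-! ### Blocks of `G₂(q)` lie on lines -/

/-- A set of which every translate under `sixGroup` that meets it is contained in it. -/
def IsSixBlock (Q : Set (Fin 6 → F)) : Prop :=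
  ∀ p ∈ sixGroup F, ∀ x ∈ Q, p x ∈ Q → ∀ y ∈ Q, p y ∈ Q

lemma IsSixBlock.mem_of_rel {Q : Set (Fin 6 → F)} (hQ : IsSixBlock Q) {x y x' y' : Fin 6 → F}
    (hx : x ∈ Q) (hy : y ∈ Q) (hx' : x' ∈ Q) (h : SixPairRel x y x' y') : y' ∈ Q := by
  obtain ⟨p, hp, rfl, rfl⟩ := h
  exact hQ p hp x hx hx' y hy

/-- With `x, y` the block contains every `y + t x` for `t ≠ 0`, since the pairs `(x, y)` and `(x, y
+ t x)` have the same form value. The form value of `y` and `y + t x` is an arbitrary nonzero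
scalar, so the block is closed under passing to non-orthogonal vectors. Two such passages join any
two nonzero vectors. -/
lemma IsSixBlock.mem_of_sixForm_ne_zero [Finite F] {Q : Set (Fin 6 → F)} (hQ : IsSixBlock Q)
    {x y : Fin 6 → F} (hx : x ∈ Q) (hy : y ∈ Q) (hxy : sixForm x y ≠ 0) {z : Fin 6 → F}
    (hz : z ≠ 0) : z ∈ Q := by
  have close : ∀ r ∈ Q, ∀ s, sixForm r s ≠ 0 → s ∈ Q := by
    intro r hr s hrs
    have h1 : y + (sixForm r s / sixForm y x) • x ∈ Q := by
      refine hQ.mem_of_rel hx hy hx (sixPairRel_of_sixForm_eq hxy ?_)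
      rw [sixForm_add_right, sixForm_smul_right, sixForm_self, mul_zero, add_zero]
    have hyx : sixForm y x ≠ 0 := by
      convert hxy using 1
      simp only [sixForm]; ring
    have h2 : sixForm y (y + (sixForm r s / sixForm y x) • x) = sixForm r s := by
      rw [sixForm_add_right, sixForm_smul_right, sixForm_self, zero_add, div_mul_cancel₀ _ hyx]
    exact hQ.mem_of_rel hy h1 hr (sixPairRel_of_sixForm_eq (by rwa [h2]) h2)
  obtain ⟨w, hxw, hzw⟩ := exists_sixForm_ne_zero_two
    (x := x) (by rintro rfl; exact hxy (sixForm_zero_left y)) hz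
  refine close w (close x hx w hxw) z ?_
  convert hzw using 1
  simp only [sixForm]; ring

/-- A block that contains a vector collinear with `sixBase` in the generalized hexagon contains two
non-orthogonal vectors. -/
lemma IsSixBlock.exists_sixForm_ne_zero_of_collinear {Q : Set (Fin 6 → F)} (hQ : IsSixBlock Q)
    (hbase : sixBase F ∈ Q) {u₁ v₂ v₃ : F} (hv : v₂ ≠ 0 ∨ v₃ ≠ 0)
    (hz : ![u₁, 0, 0, 0, v₂, v₃] ∈ Q) : ∃ x ∈ Q, ∃ y ∈ Q, sixForm x y ≠ 0 := by
  have h2 : (2 : F) = 0 := CharTwo.two_eq_zero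
  obtain ⟨w₂, w₃, hw⟩ : ∃ w₂ w₃ : F, w₂ * v₂ + w₃ * v₃ = 1 := by
    by_cases h3 : v₃ = 0
    · exact ⟨v₂⁻¹, 0, by simp_all⟩
    · exact ⟨0, v₃⁻¹, by simp_all⟩
  have hx : ![0, 0, 0, 0, v₂, v₃] ∈ Q := by
    -- An element fixing `sixBase` clears `u₁`: the added term is `u₁ (w₂ v₂ + w₃ v₃) = u₁`.
    obtain ⟨p, hp, hp'⟩ := exists_sixGroup_shear' 0 (u₁ * w₃) (u₁ * w₂)
    refine hQ.mem_of_rel hbase hz hbase ⟨p, hp, ?_, ?_⟩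
    · rw [sixBase, hp']; simp
    · rw [hp']
      have : u₁ + (u₁ * w₃ * v₃ + u₁ * w₂ * v₂) = 0 := by
        linear_combination u₁ * hw + u₁ * h2
      simp [this]
  have hy : ![0, 0, 0, 0, v₂ + w₃, v₃ + w₂] ∈ Q := by
    -- Here `r = (0, w₃, w₂)`, so `sixBase` is fixed, and `r` is added to `v` because `w·v = 1`.
    obtain ⟨p, hp, hp'⟩ := exists_sixGroup_transvection 0 w₂ w₃ 1 0 0 _ _ _ rfl rfl rfl
    refine hQ.mem_of_rel hbase hx hbase ⟨p, hp, ?_, ?_⟩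
    · rw [sixBase, hp']; simp [CharTwo.add_self_eq_zero]
    · rw [hp']
      simp [hw, CharTwo.add_self_eq_zero]
  -- With `a = (0, v₃, v₂)`, `a·v = 2 v₂ v₃ = 0`, so the shear fixes the first vector. For the
  -- second, `a·(v + r) = 1`, and its form value with its image is the square of this.
  obtain ⟨p, hp, hp'⟩ := exists_sixGroup_shear 0 v₃ v₂
  have hfix : p ![0, 0, 0, 0, v₂, v₃] = ![0, 0, 0, 0, v₂, v₃] := by
    rw [hp']
    simp [mul_comm v₃ v₂, CharTwo.add_self_eq_zero]
  refine ⟨_, hy, _, hQ p hp _ hx (by rwa [hfix]) _ hy, ?_⟩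
  rw [hp']
  have : sixForm ![0, 0, 0, 0, v₂ + w₃, v₃ + w₂]
      ![0 + (0 * 0 + v₃ * (v₂ + w₃) + v₂ * (v₃ + w₂)) * 0,
        0 + (0 * 0 + v₃ * (v₂ + w₃) + v₂ * (v₃ + w₂)) * v₃,
        0 + (0 * 0 + v₃ * (v₂ + w₃) + v₂ * (v₃ + w₂)) * v₂, 0 + (v₃ * 0 + v₂ * 0),
        v₂ + w₃ + (v₂ * 0 + 0 * 0), v₃ + w₂ + (0 * 0 + v₃ * 0)] = 1 := by
    simp [sixForm]
    grind
  rw [this]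
  exact one_ne_zero

/-- If `v₁ ≠ 0`, then `z` is not orthogonal to `sixBase`. If `v₁ = 0` and `(u₂, u₃) ≠ 0`, a shear
fixing `sixBase` moves `z` to a non-orthogonal vector, with form value `(b·u)² = 1`. The remaining
case is collinearity in the hexagon. -/
lemma IsSixBlock.exists_sixForm_ne_zero {Q : Set (Fin 6 → F)} (hQ : IsSixBlock Q)
    (hbase : sixBase F ∈ Q) {z : Fin 6 → F} (hz : z ∈ Q) (hne : ∀ c : F, z ≠ c • sixBase F) :
    ∃ x ∈ Q, ∃ y ∈ Q, sixForm x y ≠ 0 := by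
  have h2 : (2 : F) = 0 := CharTwo.two_eq_zero
  obtain ⟨u₁, u₂, u₃, v₁, v₂, v₃, rfl⟩ := exists_eq_vec_six z
  by_cases h₁ : v₁ = 0
  · subst h₁
    by_cases hu : u₂ = 0 ∧ u₃ = 0
    · obtain ⟨rfl, rfl⟩ := hu
      refine hQ.exists_sixForm_ne_zero_of_collinear hbase ?_ hz
      by_contra! h
      obtain ⟨rfl, rfl⟩ := h
      exact hne u₁ (by ext i; fin_cases i <;> simp [sixBase])
    · obtain ⟨b₂, b₃, hb⟩ : ∃ b₂ b₃ : F, b₂ * u₂ + b₃ * u₃ = 1 := by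
        by_cases h3 : u₃ = 0
        · exact ⟨u₂⁻¹, 0, by simp_all⟩
        · exact ⟨0, u₃⁻¹, by simp_all⟩
      obtain ⟨p, hp, hp'⟩ := exists_sixGroup_shear' 0 b₂ b₃
      have hfix : p (sixBase F) = sixBase F := by rw [sixBase, hp']; simp
      refine ⟨_, hz, _, hQ p hp _ hbase (by rwa [hfix]) _ hz, ?_⟩
      have h1 : sixForm ![u₁, u₂, u₃, 0, v₂, v₃] (p ![u₁, u₂, u₃, 0, v₂, v₃]) = 1 := by
        rw [hp']
        simp [sixForm]
        grind
      rw [h1]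
      exact one_ne_zero
  · exact ⟨_, hbase, _, hz, by simpa [sixForm, sixBase]⟩

/-- A nontrivial block of `sixGroup` on the nonzero vectors is contained in a line. -/
theorem IsSixBlock.exists_eq_smul [Finite F] {Q : Set (Fin 6 → F)} (hQ : IsSixBlock Q)
    (h0 : Q ⊆ {0}ᶜ) (hne : Q ≠ {0}ᶜ) {x z : Fin 6 → F} (hx : x ∈ Q) (hz : z ∈ Q) :
    ∃ c : F, z = c • x := by
  by_contra! hxz
  obtain ⟨p, hp, hpx⟩ := sixRel_sixBase (h0 hx)
  -- The image of `Q` under `p` is again a block, and it contains `sixBase = p x`.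
  have hQ' : IsSixBlock {y | (p⁻¹ : Equiv.Perm (Fin 6 → F)) y ∈ Q} := by
    intro r hr y hy hry w hw
    have := hQ (p⁻¹ * r * p) (mul_mem (mul_mem (inv_mem hp) hr) hp) _ hy (by simpa using hry) _ hw
    simpa using this
  obtain ⟨s, hs, t, ht, hst⟩ := hQ'.exists_sixForm_ne_zero (z := p z)
    (by simpa [← hpx] using hx) (by simpa using hz) (fun c hc => hxz c (by
      apply p.injective
      rw [sixGroup_smul hp, hpx, hc]))
  refine hne (h0.antisymm fun w hw => ?_)
  exact hQ.mem_of_sixForm_ne_zero hs ht (by rwa [sixForm_sixGroup (inv_mem hp)]) hw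

end SixTransitivity

/-! ### Transfer to `V`; the coefficients of a block form a group -/

section Transfer
variable {F V : Type*} [Field F] [AddCommGroup V] [Module F V]

/-- The coordinates of `e^⊥ / ⟨e⟩`, transported to `V`. -/
def sixMap (m : OctSix F ≃ₗ[F] V) : (Fin 6 → F) →ₗ[F] V :=
  m.toLinearMap ∘ₗ Submodule.mkQ _ ∘ₗ sixLift.codRestrict (octPerp F) sixLift_mem

lemma sixMap_apply (m : OctSix F ≃ₗ[F] V) (y : Fin 6 → F) :
    sixMap m y = m (Submodule.Quotient.mk ⟨sixLift y, sixLift_mem y⟩) := rfl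

lemma sixMap_injective (m : OctSix F ≃ₗ[F] V) : Function.Injective (sixMap m) := by
  rw [injective_iff_map_eq_zero]
  intro y hy
  rw [sixMap_apply, m.map_eq_zero_iff, Submodule.Quotient.mk_eq_zero,
    Submodule.submoduleOf, Submodule.mem_comap, Submodule.mem_span_singleton] at hy
  obtain ⟨c, hc⟩ := hy
  rw [← sixProj_sixLift y, ← show c • octOne = sixLift y from hc, map_smul, sixProj_octOne,
    smul_zero]

variable [CharP F 2]

lemma sixMap_sixProj (m : OctSix F ≃ₗ[F] V) (x : octPerp F) :
    sixMap m (sixProj (x : Fin 8 → F)) = m (Submodule.Quotient.mk x) := by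
  rw [sixMap_apply]
  congr 1
  rw [Submodule.Quotient.eq, Submodule.submoduleOf, Submodule.mem_comap, Submodule.mem_span_singleton]
  refine ⟨-(x : Fin 8 → F) 3, ?_⟩
  simp [sixLift_sixProj x.2]

lemma sixMap_surjective (m : OctSix F ≃ₗ[F] V) : Function.Surjective (sixMap m) := by
  intro v
  obtain ⟨x, hx⟩ := Submodule.Quotient.mk_surjective _ (m.symm v)
  exact ⟨sixProj (x : Fin 8 → F), by rw [sixMap_sixProj, hx, m.apply_symm_apply]⟩

lemma exists_mem_G2Perm (m : OctSix F ≃ₗ[F] V) {p : Equiv.Perm (Fin 6 → F)}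
    (hp : p ∈ sixGroup F) : ∃ h ∈ G2Perm m, ∀ y, h (sixMap m y) = sixMap m (p y) := by
  let e : (Fin 6 → F) ≃ V := Equiv.ofBijective _ ⟨sixMap_injective m, sixMap_surjective m⟩
  obtain ⟨g, hg, hpg⟩ := hp
  have key : ∀ y, (e.symm.trans (p.trans e)) (sixMap m y) = sixMap m (p y) := by
    intro y
    change e (p (e.symm (e y))) = e (p y)
    rw [e.symm_apply_apply]
  refine ⟨e.symm.trans (p.trans e), ⟨g, hg, fun x => ?_⟩, key⟩
  rw [← sixMap_sixProj, key, hpg, sixProj_octAut_congr hg x.2, ← sixMap_sixProj]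

variable {m : OctSix F ≃ₗ[F] V} {P : Set V}

lemma isSixBlock_preimage (hP : ∀ h ∈ G2Perm m, ∀ x ∈ P, h x ∈ P → ∀ y ∈ P, h y ∈ P) :
    IsSixBlock (sixMap m ⁻¹' P) := by
  intro p hp x hx hpx y hy
  obtain ⟨h, hh, key⟩ := exists_mem_G2Perm m hp
  have := hP h hh _ hx (by rwa [key]) _ hy
  rwa [key] at this

/-- A nontrivial block of `G₂(q)` on the nonzero vectors is contained in a line. -/
theorem exists_eq_smul_of_G2Perm_block [Finite F]
    (hP : ∀ h ∈ G2Perm m, ∀ x ∈ P, h x ∈ P → ∀ y ∈ P, h y ∈ P)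
    (h0 : P ⊆ {0}ᶜ) (hne : P ≠ {0}ᶜ) {x z : V} (hx : x ∈ P) (hz : z ∈ P) :
    ∃ c : F, z = c • x := by
  obtain ⟨x, rfl⟩ := sixMap_surjective m x
  obtain ⟨z, rfl⟩ := sixMap_surjective m z
  have hzero : sixMap m ⁻¹' {0}ᶜ = {0}ᶜ := by
    ext y
    simpa using (map_eq_zero_iff _ (sixMap_injective m)).not
  obtain ⟨c, rfl⟩ := (isSixBlock_preimage hP).exists_eq_smul
    (by rw [← hzero]; exact Set.preimage_mono h0)
    (fun h => hne (by
      rw [← hzero] at h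
      exact (sixMap_surjective m).preimage_injective h)) hx hz
  exact ⟨c, map_smul _ _ _⟩

/-- Transitivity gives an element with `x ↦ a • x`; by linearity it multiplies the whole line by
`a`. -/
lemma exists_G2Perm_smul [Finite F] (m : OctSix F ≃ₗ[F] V) {x : V} (hx : x ≠ 0) {a : F}
    (ha : a ≠ 0) : ∃ h ∈ G2Perm m, ∀ b : F, h (b • x) = (b * a) • x := by
  obtain ⟨x, rfl⟩ := sixMap_surjective m x
  have hx' : x ≠ 0 := by rintro rfl; exact hx (map_zero _)
  obtain ⟨p, hp, hpx⟩ := sixRel_of_ne_zero hx' (smul_ne_zero ha hx')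
  obtain ⟨h, hh, key⟩ := exists_mem_G2Perm m hp
  refine ⟨h, hh, fun b => ?_⟩
  rw [← map_smul, key, sixGroup_smul hp, hpx, smul_smul, map_smul]

lemma mul_smul_mem_of_G2Perm_block [Finite F]
    (hP : ∀ h ∈ G2Perm m, ∀ x ∈ P, h x ∈ P → ∀ y ∈ P, h y ∈ P)
    (h0 : P ⊆ {0}ᶜ) {x : V} (hx : x ∈ P) {a b : F} (ha : a • x ∈ P) (hb : b • x ∈ P) :
    (a * b) • x ∈ P := by
  have hb0 : b ≠ 0 := by rintro rfl; exact h0 hb (zero_smul F x)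
  obtain ⟨h, hh, key⟩ := exists_G2Perm_smul m (h0 hx) hb0
  rw [← key]
  refine hP h hh x hx ?_ _ ha
  rwa [← one_smul F x, key, one_mul]

lemma inv_smul_mem_of_G2Perm_block [Finite F]
    (hP : ∀ h ∈ G2Perm m, ∀ x ∈ P, h x ∈ P → ∀ y ∈ P, h y ∈ P)
    (h0 : P ⊆ {0}ᶜ) {x : V} (hx : x ∈ P) {a : F} (ha : a • x ∈ P) : a⁻¹ • x ∈ P := by
  have ha0 : a ≠ 0 := by rintro rfl; exact h0 ha (zero_smul F x)
  obtain ⟨h, hh, key⟩ := exists_G2Perm_smul m (h0 hx) (inv_ne_zero ha0)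
  have := hP h hh _ ha (by rwa [key, mul_inv_cancel₀ ha0, one_smul]) _ hx
  rwa [← one_smul F x, key, one_mul] at this

end Transfer

/-! ### Blocks `c + K (d - c)` on affine lines -/

section LineBlocks
variable {F V : Type*} [Field F]

/-- A set that consists of zero and the elements of a multiplicative group of a field. -/
structure IsGroupWithZeroSet (K : Set F) : Prop where
  zero_mem : 0 ∈ K
  one_mem : 1 ∈ K
  mul_mem : ∀ {a b}, a ∈ K → b ∈ K → a * b ∈ K
  inv_mem : ∀ {a}, a ∈ K → a⁻¹ ∈ K

/-- In a finite field the subgroups of the multiplicative group are determined by their orders. -/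
lemma Subgroup.mem_iff_pow_card_eq_one [Finite F] (S : Subgroup Fˣ) (u : Fˣ) :
    u ∈ S ↔ u ^ Nat.card S = 1 := by
  classical
  have := Fintype.ofFinite Fˣ
  have hle := IsCyclic.card_pow_eq_one_le (α := Fˣ) (n := Nat.card S) Nat.card_pos
  have hsub : (S : Set Fˣ).toFinset ⊆
      Finset.univ.filter fun u : Fˣ => u ^ Nat.card S = 1 := by
    intro v hv
    simp only [Set.mem_toFinset, SetLike.mem_coe] at hv
    have h1 : (⟨v, hv⟩ : S) ^ Nat.card S = 1 := pow_card_eq_one'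
    exact Finset.mem_filter.mpr ⟨Finset.mem_univ v, congrArg Subtype.val h1⟩
  have heq := Finset.eq_of_subset_of_card_le hsub (by
    rw [Set.toFinset_card]
    simpa [Nat.card_eq_fintype_card] using hle)
  simpa using Finset.ext_iff.mp heq u

/-- The nonzero part of `K` is the set of all units killed by its order, a condition that field
automorphisms preserve. -/
lemma IsGroupWithZeroSet.map_mem [Finite F] {K : Set F} (hK : IsGroupWithZeroSet K)
    (s : F ≃+* F) {a : F} (ha : a ∈ K) : s a ∈ K := by
  by_cases h : a = 0
  · subst h
    simpa using ha
  let S : Subgroup Fˣ :=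
    { carrier := {u | (u : F) ∈ K}
      one_mem' := by simpa using hK.one_mem
      mul_mem' := fun hu hv => by simpa using hK.mul_mem hu hv
      inv_mem' := fun {u} hu => by simpa using hK.inv_mem hu }
  have h1 : Units.mk0 a h ∈ S := ha
  have h2 : Units.map (s : F →* F) (Units.mk0 a h) ∈ S := by
    rw [S.mem_iff_pow_card_eq_one] at h1 ⊢
    rw [← map_pow, h1, map_one]
  exact h2

variable [AddCommGroup V] [Module F V] {K : Set F}

/-- The image of `K` under the affine map `F → V` with `0 ↦ c` and `1 ↦ d`. -/
def lineBlock (K : Set F) (c d : V) : Set V := {x | ∃ a ∈ K, x = c + a • (d - c)}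

lemma left_mem_lineBlock (hK : IsGroupWithZeroSet K) (c d : V) : c ∈ lineBlock K c d :=
  ⟨0, hK.zero_mem, by simp⟩

lemma right_mem_lineBlock (hK : IsGroupWithZeroSet K) (c d : V) : d ∈ lineBlock K c d :=
  ⟨1, hK.one_mem, by simp⟩

lemma ncard_lineBlock {c d : V} (h : c ≠ d) : (lineBlock K c d).ncard = K.ncard := by
  have : lineBlock K c d = (fun a : F => c + a • (d - c)) '' K := by
    ext x
    simp only [lineBlock, Set.mem_ofPred_eq, Set.mem_image, eq_comm]
  rw [this, Set.ncard_image_of_injective]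
  intro a b hab
  exact smul_left_injective F (sub_ne_zero.mpr h.symm) (add_left_cancel hab)

lemma lineBlock_eq_of_mem (hK : IsGroupWithZeroSet K) {c d x : V} (hx : x ∈ lineBlock K c d)
    (hxc : x ≠ c) : lineBlock K c d = lineBlock K c x := by
  obtain ⟨a, ha, rfl⟩ := hx
  have ha0 : a ≠ 0 := by rintro rfl; simp at hxc
  ext y
  constructor
  · rintro ⟨b, hb, rfl⟩
    refine ⟨b * a⁻¹, hK.mul_mem hb (hK.inv_mem ha), ?_⟩
    rw [add_sub_cancel_left, smul_smul, mul_assoc, inv_mul_cancel₀ ha0, mul_one]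
  · rintro ⟨b, hb, rfl⟩
    exact ⟨b * a, hK.mul_mem hb ha, by rw [add_sub_cancel_left, smul_smul]⟩

/-- A semilinear affine map only twists the coefficient by a field automorphism, which preserves
`K`. The inverse map gives the other inclusion. -/
lemma image_lineBlock [Finite F] (hK : IsGroupWithZeroSet K) {g : Equiv.Perm V}
    (hg : g ∈ affineSemilinearGroup F V) (c d : V) :
    g • lineBlock K c d = lineBlock K (g c) (g d) := by
  have key : ∀ {g : Equiv.Perm V}, g ∈ affineSemilinearGroup F V → ∀ (c d : V),
      ∀ x ∈ lineBlock K c d, g x ∈ lineBlock K (g c) (g d) := by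
    rintro g ⟨s, A, b, hA, hg⟩ c d x ⟨a, ha, rfl⟩
    refine ⟨s a, hK.map_mem s ha, ?_⟩
    rw [hg, hg, hg, map_add, hA, map_sub]
    abel_nf
  ext x
  rw [Set.mem_smul_set_iff_inv_smul_mem]
  constructor
  · intro h
    simpa using key hg c d _ h
  · intro h
    simpa using key (inv_mem hg) _ _ _ h

variable (K V) in
/-- The set of all images of `K` under affine maps `F → V` that are not constant. -/
def lineBlocks : Set (Set V) := {B | ∃ c d, c ≠ d ∧ B = lineBlock K c d}

variable (K V) in
/-- The blocks in `lineBlocks`, together with the image of zero. -/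
def lineFlags : Set (V × Set V) := {w | ∃ c d, c ≠ d ∧ w = (c, lineBlock K c d)}

lemma eq_lineBlock_of_mem_lineFlags (hK : IsGroupWithZeroSet K) {c x : V} {B : Set V}
    (h : (c, B) ∈ lineFlags V K) (hx : x ∈ B) (hxc : x ≠ c) : B = lineBlock K c x := by
  obtain ⟨c', d, hcd, h⟩ := h
  obtain ⟨rfl, rfl⟩ := Prod.mk.inj h
  exact lineBlock_eq_of_mem hK hx hxc

lemma left_mem_of_mem_lineFlags (hK : IsGroupWithZeroSet K) {c : V} {B : Set V}
    (h : (c, B) ∈ lineFlags V K) : c ∈ B := by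
  obtain ⟨c', d, hcd, h⟩ := h
  obtain ⟨rfl, rfl⟩ := Prod.mk.inj h
  exact left_mem_lineBlock hK _ _

lemma flagPairs_lineFlags (hK : IsGroupWithZeroSet K) : flagPairs (lineFlags V K) =
    {p | ∃ c d, c ≠ d ∧ p = ((c, lineBlock K c d), (d, lineBlock K d c))} := by
  ext ⟨⟨c, M⟩, ⟨d, N⟩⟩
  constructor
  · rintro ⟨h1, h2, h3, h4, h5⟩
    exact ⟨c, d, h3, by rw [eq_lineBlock_of_mem_lineFlags hK h1 h5.1 (Ne.symm h3),
      eq_lineBlock_of_mem_lineFlags hK h2 h4.2 h3]⟩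
  · rintro ⟨c', d', h, h'⟩
    simp only [Prod.mk.injEq] at h'
    obtain ⟨⟨rfl, rfl⟩, ⟨rfl, rfl⟩⟩ := h'
    exact ⟨⟨_, _, h, rfl⟩, ⟨_, _, h.symm, rfl⟩, h,
      ⟨left_mem_lineBlock hK _ _, right_mem_lineBlock hK _ _⟩,
      ⟨right_mem_lineBlock hK _ _, left_mem_lineBlock hK _ _⟩⟩

/-- Adjacent flags have blocks on the same `F`-line, so no path leads from the line through `e` to
the block of `w`. -/
lemma not_preconnected_flagGraph_lineFlags (hK : IsGroupWithZeroSet K) {e w : V} (he : e ≠ 0)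
    (hw : w ∉ Submodule.span F {e}) : ¬ (flagGraph (lineFlags V K)).Preconnected := by
  have hw0 : w ≠ 0 := by rintro rfl; exact hw (zero_mem _)
  intro hconn
  have hstep : ∀ x y : lineFlags V K, (flagGraph (lineFlags V K)).Reachable x y →
      (x : V × Set V).2 ⊆ Submodule.span F {e} → (y : V × Set V).2 ⊆ Submodule.span F {e} := by
    rintro x y ⟨p⟩
    induction p with
    | nil => exact id
    | @cons x y z hadj p ih =>
      refine fun hx => ih ?_
      have hadj' : ((x : V × Set V), (y : V × Set V)) ∈ flagPairs (lineFlags V K) := hadj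
      rw [flagPairs_lineFlags hK] at hadj'
      obtain ⟨c, d, hcd, h⟩ := hadj'
      obtain ⟨hx', hy'⟩ := Prod.mk.inj h
      rw [hx'] at hx
      rw [hy']
      have hc := hx (left_mem_lineBlock hK c d)
      have hd := hx (right_mem_lineBlock hK c d)
      rintro v ⟨a, -, rfl⟩
      exact add_mem hd (Submodule.smul_mem _ _ (sub_mem hc hd))
  have := hstep ⟨(0, lineBlock K 0 e), 0, e, he.symm, rfl⟩ ⟨(0, lineBlock K 0 w), 0, w, hw0.symm, rfl⟩
    (hconn _ _) (by
      rintro v ⟨a, -, rfl⟩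
      rw [zero_add, sub_zero]
      exact Submodule.smul_mem _ _ (Submodule.mem_span_singleton_self e))
  exact hw (this (right_mem_lineBlock hK 0 w))

/-- For `a ≠ 0`, `a + b = a (1 + b a⁻¹)`. -/
lemma IsGroupWithZeroSet.add_mem (hK : IsGroupWithZeroSet K) (h : ∀ a ∈ K, 1 + a ∈ K) {a b : F}
    (ha : a ∈ K) (hb : b ∈ K) : a + b ∈ K := by
  by_cases ha0 : a = 0
  · rwa [ha0, zero_add]
  · have := hK.mul_mem ha (h _ (hK.mul_mem hb (hK.inv_mem ha)))
    convert this using 1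
    field_simp

variable [CharP F 2]

/-- Exchanging the roles of `c` and `d` turns the coefficient `a` into `1 - a = 1 + a`. -/
lemma one_add_mem_of_lineBlock_comm {c d : V} (h : c ≠ d)
    (hcd : lineBlock K c d = lineBlock K d c) {a : F} (ha : a ∈ K) : 1 + a ∈ K := by
  have h1 : c + a • (d - c) ∈ lineBlock K d c := by
    rw [← hcd]
    exact ⟨a, ha, rfl⟩
  obtain ⟨b, hb, h2⟩ := h1
  have h3 : (a + b - 1) • (d - c) = 0 := by
    have h4 : c + a • (d - c) - (d + b • (c - d)) = 0 := sub_eq_zero.mpr h2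
    rw [← h4]
    module
  rcases smul_eq_zero.mp h3 with h4 | h4
  · convert hb using 1
    have h2 : (2 : F) = 0 := CharTwo.two_eq_zero
    linear_combination h4 + (1 - b) * h2
  · exact absurd (sub_eq_zero.mp h4).symm h

lemma IsGroupWithZeroSet.exists_subfield_iff (hK : IsGroupWithZeroSet K) :
    (∃ S : Subfield F, (S : Set F) = K) ↔ ∀ a ∈ K, 1 + a ∈ K := by
  constructor
  · rintro ⟨S, rfl⟩ a ha
    exact S.add_mem S.one_mem ha
  · intro h
    exact ⟨{ carrier := K
             zero_mem' := hK.zero_mem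
             one_mem' := hK.one_mem
             mul_mem' := hK.mul_mem
             add_mem' := hK.add_mem h
             neg_mem' := fun {a} ha => by
              change -a ∈ K
              rwa [CharTwo.neg_eq]
             inv_mem' := fun a ha => hK.inv_mem ha }, rfl⟩

/-! ### Counting the blocks through two points -/

lemma lineBlock_unique_of_one_add_mem (hK : IsGroupWithZeroSet K) (h : ∀ a ∈ K, 1 + a ∈ K)
    {c d x y : V} (hx : x ∈ lineBlock K c d) (hy : y ∈ lineBlock K c d) (hxy : x ≠ y) :
    lineBlock K c d = lineBlock K x y := by
  have hcomm : ∀ c d : V, lineBlock K c d ⊆ lineBlock K d c := by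
    rintro c d z ⟨a, ha, rfl⟩
    refine ⟨1 + a, h a ha, ?_⟩
    have h2 : (2 : F) = 0 := CharTwo.two_eq_zero
    have h3 : (2 * a) • (d - c) = 0 := by rw [h2, zero_mul, zero_smul]
    rw [← sub_eq_zero, ← h3]
    module
  by_cases hxc : x = c
  · subst hxc
    exact lineBlock_eq_of_mem hK hy hxy.symm
  · rw [lineBlock_eq_of_mem hK hx hxc, (hcomm c x).antisymm (hcomm x c)] at hy ⊢
    exact lineBlock_eq_of_mem hK hy hxy.symm

variable (K) in
/-- The blocks through two given points. -/
def lineBlocksThrough (x y : V) : Set (Set V) := {B ∈ lineBlocks V K | x ∈ B ∧ y ∈ B}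

lemma ncard_lineBlocksThrough_of_one_add_mem (hK : IsGroupWithZeroSet K)
    (h : ∀ a ∈ K, 1 + a ∈ K) {x y : V} (hxy : x ≠ y) : (lineBlocksThrough K x y).ncard = 1 := by
  rw [Set.ncard_eq_one]
  refine ⟨lineBlock K x y, Set.eq_singleton_iff_unique_mem.mpr ⟨⟨⟨x, y, hxy, rfl⟩,
    left_mem_lineBlock hK x y, right_mem_lineBlock hK x y⟩, ?_⟩⟩
  rintro B ⟨⟨c, d, hcd, rfl⟩, hx, hy⟩
  exact lineBlock_unique_of_one_add_mem hK h hx hy hxy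

/-- If a block had centres `c ≠ c'`, it would equal both `lineBlock K c c'` and `lineBlock K c' c`,
which forces closure under `a ↦ 1 + a`. -/
lemma lineBlock_center_unique (hK : IsGroupWithZeroSet K) (h : ¬ ∀ a ∈ K, 1 + a ∈ K) {c d c' d' : V}
    (hcd : lineBlock K c d = lineBlock K c' d') : c = c' := by
  by_contra hne
  apply h
  intro a ha
  refine one_add_mem_of_lineBlock_comm (K := K) hne ?_ ha
  rw [← lineBlock_eq_of_mem hK (c := c) (d := d) (hcd ▸ left_mem_lineBlock hK c' d') (Ne.symm hne),
    ← lineBlock_eq_of_mem hK (c := c') (d := d') (hcd ▸ left_mem_lineBlock hK c d) hne, hcd]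

lemma ncard_lineBlocksThrough_of_not (hK : IsGroupWithZeroSet K)
    (h : ¬ ∀ a ∈ K, 1 + a ∈ K) {x y : V} (hxy : x ≠ y) :
    (lineBlocksThrough K x y).ncard = K.ncard := by
  classical
  have h2 : (2 : F) = 0 := CharTwo.two_eq_zero
  -- The centre of a block through `x` and `y` lies on their line, at `x + t (y - x)`. The second
  -- point is `x`, or `y` when the centre is `x`. For `t ≠ 0`, `y` has coefficient `1 + t⁻¹`; at `t
  -- = 0` the convention `0⁻¹ = 0` gives `1 ∈ K`, as it should. Thus `t ↦ 1 + t⁻¹` matches the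
  -- admissible centres with `K`.
  let φ : F → Set V := fun t => lineBlock K (x + t • (y - x)) (if t = 0 then y else x)
  have hinj : Function.Injective φ := by
    intro s t hst
    exact smul_left_injective F (sub_ne_zero.mpr hxy.symm)
      (add_left_cancel (lineBlock_center_unique hK h hst))
  have himage : lineBlocksThrough K x y = φ '' ((fun t => 1 + t⁻¹) ⁻¹' K) := by
    ext B
    constructor
    · rintro ⟨⟨c, d, hcd, rfl⟩, hx, hy⟩
      by_cases hxc : x = c
      · subst hxc
        refine ⟨0, by simpa using hK.one_mem, ?_⟩
        simp [φ, lineBlock_eq_of_mem hK hy hxy.symm]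
      · rw [lineBlock_eq_of_mem hK hx hxc] at hy ⊢
        obtain ⟨s, hs, rfl⟩ := hy
        have hs1 : 1 + s ≠ 0 := by
          intro h1
          have : s = 1 := by linear_combination h1 - h2
          subst this
          simp at hxy
        refine ⟨(1 + s)⁻¹, ?_, ?_⟩
        · change 1 + (1 + s)⁻¹⁻¹ ∈ K
          rw [inv_inv]
          convert hs using 1
          linear_combination h2
        · have h3 : x + (1 + s)⁻¹ • (c + s • (x - c) - x) = c := by
            have h4 : c + s • (x - c) - x = (1 + s) • (c - x) + (2 * s) • (x - c) := by module
            rw [h4, h2, zero_mul, zero_smul, add_zero, smul_smul, inv_mul_cancel₀ hs1, one_smul,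
              add_sub_cancel]
          simp only [φ, if_neg (inv_ne_zero hs1), h3]
    · rintro ⟨t, ht, rfl⟩
      by_cases ht0 : t = 0
      · subst ht0
        simp only [φ, if_pos, zero_smul, add_zero]
        exact ⟨⟨x, y, hxy, rfl⟩, left_mem_lineBlock hK x y, right_mem_lineBlock hK x y⟩
      · simp only [φ, if_neg ht0]
        refine ⟨⟨_, _, ?_, rfl⟩, right_mem_lineBlock hK _ _, 1 + t⁻¹, ht, ?_⟩
        · simp [ht0, sub_eq_zero, hxy.symm]
        · have h3 : x + t • (y - x) + (1 + t⁻¹) • (x - (x + t • (y - x))) =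
              x - (t⁻¹ * t) • (y - x) := by module
          rw [h3, inv_mul_cancel₀ ht0, one_smul]
          have h4 : (2 : F) • (y - x) = 0 := by rw [h2, zero_smul]
          rw [← sub_eq_zero, ← h4]
          module
  rw [himage, Set.ncard_image_of_injective _ hinj]
  refine Set.ncard_preimage_of_injective_subset_range ?_ ?_
  · intro s t hst
    exact inv_injective (add_left_cancel hst)
  · intro a _
    exact ⟨(a - 1)⁻¹, by simp⟩

end LineBlocks

/-! ### Designs, orbits and strong feasibility -/

section Designs
variable {F V : Type*} [Field F] [AddCommGroup V] [Module F V]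
  {K : Set F} {G : Subgroup (Equiv.Perm V)}

lemma setOf_subset_eq_lineBlocksThrough (x y : V) :
    {B ∈ lineBlocks V K | ({x, y} : Set V) ⊆ B} = lineBlocksThrough K x y := by
  simp only [Set.pair_subset_iff, lineBlocksThrough]

lemma isDesign_two_lineBlocks [Finite V] {l : ℕ} (hl : 0 < l)
    (h : ∀ x y : V, x ≠ y → (lineBlocksThrough K x y).ncard = l) :
    IsDesign 2 (Nat.card V) K.ncard l (lineBlocks V K) where
  finite := inferInstance
  card_points := rfl
  card_block := by
    rintro B ⟨c, d, hcd, rfl⟩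
    exact ncard_lineBlock hcd
  pos := hl
  card_through := by
    classical
    intro T hT
    obtain ⟨x, y, hxy, rfl⟩ := Finset.card_eq_two.mp hT
    rw [Finset.coe_pair, setOf_subset_eq_lineBlocksThrough, h x y hxy]

variable [Finite F]

lemma smul_lineBlock (hK : IsGroupWithZeroSet K) (hG : G ≤ affineSemilinearGroup F V) (g : G)
    (c d : V) : g • lineBlock K c d = lineBlock K (g • c) (g • d) :=
  image_lineBlock hK (hG g.2) c d

lemma orbit_lineBlock (hK : IsGroupWithZeroSet K) (hG : G ≤ affineSemilinearGroup F V)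
    (hG2 : MulAction.IsMultiplyPretransitive G V 2) {c d : V} (hcd : c ≠ d) :
    MulAction.orbit G (lineBlock K c d) = lineBlocks V K := by
  rw [MulAction.is_two_pretransitive_iff] at hG2
  ext B
  constructor
  · rintro ⟨g, rfl⟩
    exact ⟨_, _, (MulAction.injective g).ne hcd, smul_lineBlock hK hG g c d⟩
  · rintro ⟨x, y, hxy, rfl⟩
    obtain ⟨g, rfl, rfl⟩ := hG2 hcd hxy
    exact ⟨g, smul_lineBlock hK hG g c d⟩

lemma orbit_lineFlag (hK : IsGroupWithZeroSet K) (hG : G ≤ affineSemilinearGroup F V)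
    (hG2 : MulAction.IsMultiplyPretransitive G V 2) {c d : V} (hcd : c ≠ d) :
    MulAction.orbit G (c, lineBlock K c d) = lineFlags V K := by
  rw [MulAction.is_two_pretransitive_iff] at hG2
  ext w
  constructor
  · rintro ⟨g, rfl⟩
    exact ⟨_, _, (MulAction.injective g).ne hcd,
      Prod.ext rfl (smul_lineBlock hK hG g c d)⟩
  · rintro ⟨x, y, hxy, rfl⟩
    obtain ⟨g, rfl, rfl⟩ := hG2 hcd hxy
    exact ⟨g, Prod.ext rfl (smul_lineBlock hK hG g c d)⟩

lemma flagPairs_lineFlags_eq_orbit (hK : IsGroupWithZeroSet K)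
    (hG : G ≤ affineSemilinearGroup F V) (hG2 : MulAction.IsMultiplyPretransitive G V 2)
    {c d : V} (hcd : c ≠ d) : flagPairs (lineFlags V K) =
      MulAction.orbit G ((c, lineBlock K c d), (d, lineBlock K d c)) := by
  rw [MulAction.is_two_pretransitive_iff] at hG2
  rw [flagPairs_lineFlags hK]
  ext w
  constructor
  · rintro ⟨x, y, hxy, rfl⟩
    obtain ⟨g, rfl, rfl⟩ := hG2 hcd hxy
    exact ⟨g, Prod.ext (Prod.ext rfl (smul_lineBlock hK hG g c d))
      (Prod.ext rfl (smul_lineBlock hK hG g d c))⟩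
  · rintro ⟨g, rfl⟩
    exact ⟨_, _, (MulAction.injective g).ne hcd,
      Prod.ext (Prod.ext rfl (smul_lineBlock hK hG g c d))
      (Prod.ext rfl (smul_lineBlock hK hG g d c))⟩

lemma IsGroupWithZeroSet.two_le_ncard (hK : IsGroupWithZeroSet K) : 2 ≤ K.ncard := by
  exact (Set.one_lt_ncard (Set.toFinite K)).mpr ⟨0, hK.zero_mem, 1, hK.one_mem, zero_ne_one⟩

lemma isDesign_one_lineBlocks [Finite V] [Nontrivial V] (hK : IsGroupWithZeroSet K)
    (hG : G ≤ affineSemilinearGroup F V) (hG2 : MulAction.IsMultiplyPretransitive G V 2) :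
    ∃ l, IsDesign 1 (Nat.card V) K.ncard l (lineBlocks V K) := by
  have hG1 : MulAction.IsPretransitive G V := MulAction.isPretransitive_of_is_two_pretransitive
  have hinv : ∀ g : G, ∀ B, g • B ∈ lineBlocks V K ↔ B ∈ lineBlocks V K := by
    obtain ⟨c, d, hcd⟩ := exists_pair_ne V
    intro g B
    rw [← orbit_lineBlock hK hG hG2 hcd]
    exact ⟨fun h => by simpa using MulAction.mem_orbit_of_mem_orbit g⁻¹ h,
      MulAction.mem_orbit_of_mem_orbit g⟩
  obtain ⟨d, hd⟩ := exists_ne (0 : V)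
  refine ⟨{B ∈ lineBlocks V K | 0 ∈ B}.ncard, inferInstance, rfl, ?_, ?_, ?_⟩
  · rintro B ⟨c, d, hcd, rfl⟩
    exact ncard_lineBlock hcd
  · rw [Set.ncard_pos]
    exact ⟨lineBlock K 0 d, ⟨0, d, hd.symm, rfl⟩, left_mem_lineBlock hK 0 d⟩
  · intro T hT
    obtain ⟨x, rfl⟩ := Finset.card_eq_one.mp hT
    obtain ⟨g, rfl⟩ := MulAction.exists_smul_eq G 0 x
    simp only [Finset.coe_singleton, Set.singleton_subset_iff]
    have : {B ∈ lineBlocks V K | g • (0 : V) ∈ B} = (g • ·) '' {B ∈ lineBlocks V K | 0 ∈ B} := by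
      ext B
      constructor
      · rintro ⟨hB, h0⟩
        refine ⟨g⁻¹ • B, ⟨(hinv _ _).mpr hB, ?_⟩, smul_inv_smul g B⟩
        rwa [Set.mem_smul_set_iff_inv_smul_mem, inv_inv]
      · rintro ⟨B, ⟨hB, h0⟩, rfl⟩
        exact ⟨(hinv _ _).mpr hB, Set.smul_mem_smul_set h0⟩
    rw [this, Set.ncard_image_of_injective _ (MulAction.injective g)]

/-- A block is determined by its centre and one more point, which gives the intersection property
and, with 2-transitivity, transitivity on the noncentral points. The vector `w` off the line of `e`
supplies a second flag at each point. -/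
theorem isStronglyFeasible_lineFlags [Finite V] (hK : IsGroupWithZeroSet K)
    (hG : G ≤ affineSemilinearGroup F V) (hG2 : MulAction.IsMultiplyPretransitive G V 2)
    {e w : V} (he : e ≠ 0) (hw : w ∉ Submodule.span F {e}) :
    IsStronglyFeasible G (lineBlocks V K) (lineFlags V K) where
  design := by
    have : Nontrivial V := ⟨e, 0, he⟩
    obtain ⟨l, hl⟩ := isDesign_one_lineBlocks hK hG hG2
    exact ⟨K.ncard, l, hK.two_le_ncard, hl⟩
  point_transitive := MulAction.isPretransitive_of_is_two_pretransitive
  block_transitive := ⟨_, (orbit_lineBlock hK hG hG2 he.symm).symm⟩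
  flag_orbit := ⟨(0, lineBlock K 0 e), left_mem_lineBlock hK 0 e, ⟨0, e, he.symm, rfl⟩,
    (orbit_lineFlag hK hG hG2 he.symm).symm⟩
  two_le := by
    intro x
    have hw0 : w ≠ 0 := by rintro rfl; exact hw (zero_mem _)
    refine (Set.one_lt_ncard (Set.toFinite _)).mpr
      ⟨(x, lineBlock K x (x + e)), ⟨⟨x, x + e, by simpa using he, rfl⟩, rfl⟩,
        (x, lineBlock K x (x + w)), ⟨⟨x, x + w, by simpa using hw0, rfl⟩, rfl⟩, ?_⟩
    intro h
    have h1 : x + w ∈ lineBlock K x (x + e) := by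
      rw [(Prod.mk.inj h).2]
      exact right_mem_lineBlock hK _ _
    obtain ⟨a, -, h2⟩ := h1
    rw [add_sub_cancel_left] at h2
    exact hw (add_left_cancel h2 ▸ Submodule.smul_mem _ _ (Submodule.mem_span_singleton_self e))
  transitive := by
    rintro c B hB x ⟨hx, hxc⟩ y ⟨hy, hyc⟩
    obtain ⟨g, h1, h2⟩ := (MulAction.is_two_pretransitive_iff.mp hG2)
      (Ne.symm hxc : c ≠ x) (Ne.symm hyc : c ≠ y)
    refine ⟨g, h1, ?_, h2⟩
    conv_lhs => rw [eq_lineBlock_of_mem_lineFlags hK hB hx hxc]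
    rw [smul_lineBlock hK hG, h1, h2, ← eq_lineBlock_of_mem_lineFlags hK hB hy hyc]
  inter_eq := by
    intro c B B' hB hB' hne
    refine Set.eq_singleton_iff_unique_mem.mpr
      ⟨⟨left_mem_of_mem_lineFlags hK hB, left_mem_of_mem_lineFlags hK hB'⟩, ?_⟩
    rintro x ⟨hx, hx'⟩
    by_contra hxc
    exact hne ((eq_lineBlock_of_mem_lineFlags hK hB hx hxc).trans
      (eq_lineBlock_of_mem_lineFlags hK hB' hx' hxc).symm)

theorem exists_isDesign_two_lineBlocks [CharP F 2] [Finite V] (hK : IsGroupWithZeroSet K) :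
    ∃ l, IsDesign 2 (Nat.card V) K.ncard l (lineBlocks V K) ∧ (l = 1 ∨ l = K.ncard) ∧
      (l = 1 ↔ ∃ S : Subfield F, (S : Set F) = K) := by
  have hcard := hK.two_le_ncard
  rw [hK.exists_subfield_iff]
  by_cases h : ∀ a ∈ K, 1 + a ∈ K
  · exact ⟨1, isDesign_two_lineBlocks one_pos
      fun x y hxy => ncard_lineBlocksThrough_of_one_add_mem hK h hxy, .inl rfl, by simpa using h⟩
  · refine ⟨K.ncard, isDesign_two_lineBlocks (by omega)
      fun x y hxy => ncard_lineBlocksThrough_of_not hK h hxy, .inr rfl, ?_⟩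
    simp only [h, iff_false]
    omega

end Designs

/-! ### The main theorem -/

theorem lemma4p12 {F : Type*} [Field F] [Fintype F] [CharP F 2] (hq : 2 < Fintype.card F)
    (m : OctSix F ≃ₗ[F] (Fin 6 → F))
    (G : Subgroup (Equiv.Perm (Fin 6 → F)))
    (hG : G ≤ affineSemilinearGroup F (Fin 6 → F))
    (hG2 : MulAction.IsMultiplyPretransitive G (Fin 6 → F) 2)
    (G₀ : Subgroup (Equiv.Perm (Fin 6 → F)))
    (hG₀ : G₀ = G ⊓ MulAction.stabilizer (Equiv.Perm (Fin 6 → F)) (0 : Fin 6 → F))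
    (hle : G2Perm m ≤ G₀) (hnormal : ((G2Perm m).subgroupOf G₀).Normal)
    (e₁ : Fin 6 → F) (he₁ : e₁ = ![1, 0, 0, 0, 0, 0])
    (P : Set (Fin 6 → F)) (hP₀ : P ⊆ {0}ᶜ) (hblock : MulAction.IsBlock G₀ P)
    (hP₁ : P.Nontrivial) (hP₂ : P ≠ {0}ᶜ) (heP : e₁ ∈ P)
    (L : Set (Fin 6 → F)) (hL : L = P ∪ {0})
    (𝓑 : Set (Set (Fin 6 → F))) (h𝓑 : 𝓑 = MulAction.orbit G L)
    (Ω : Set ((Fin 6 → F) × Set (Fin 6 → F)))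
    (hΩ : Ω = MulAction.orbit G ((0 : Fin 6 → F), L)) :
    (P ⊆ (Submodule.span F {e₁} : Set (Fin 6 → F)) ∧
      ∃ S : Subgroup Fˣ, (S : Set Fˣ) = {a : Fˣ | (a : F) • e₁ ∈ P}) ∧
    (∃ l : ℕ, IsDesign 2 (Fintype.card F ^ 6) (P.ncard + 1) l 𝓑 ∧
      (∀ (g : G), ∀ B ∈ 𝓑, g • B ∈ 𝓑) ∧
      (l = 1 ∨ l = P.ncard + 1) ∧
      IsStronglyFeasible G 𝓑 Ω ∧
      (l = 1 ↔ ∃ K : Subfield F, (K : Set F) = {a : F | a ≠ 0 ∧ a • e₁ ∈ P} ∪ {0})) ∧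
    ((∃ p ∈ flagPairs Ω, flagPairs Ω = MulAction.orbit G p) ∧
      ¬ (flagGraph Ω).Preconnected) := by
  have he : e₁ ≠ 0 := hP₀ heP
  have hP : ∀ h ∈ G2Perm m, ∀ x ∈ P, h x ∈ P → ∀ y ∈ P, h y ∈ P := by
    intro h hh x hx hhx y hy
    -- Translates of a block are equal or disjoint, and these two share `h x`.
    have heq : (⟨h, hle hh⟩ : G₀) • P = (1 : G₀) • P := by
      by_contra hne
      refine Set.disjoint_left.mp (hblock hne) (Set.smul_mem_smul_set hx) ?_
      rw [one_smul]
      exact hhx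
    rw [one_smul] at heq
    rw [← heq]
    exact Set.smul_mem_smul_set hy
  have hline : ∀ z ∈ P, ∃ c : F, z = c • e₁ := fun z hz =>
    exists_eq_smul_of_G2Perm_block hP hP₀ hP₂ heP hz
  set K : Set F := {a : F | a ≠ 0 ∧ a • e₁ ∈ P} ∪ {0} with hKdef
  have hK : IsGroupWithZeroSet K := by
    refine ⟨.inr rfl, .inl ⟨one_ne_zero, by rwa [one_smul]⟩, ?_, ?_⟩
    · rintro a b (⟨ha, haP⟩ | rfl) (⟨hb, hbP⟩ | rfl)
      · exact .inl ⟨mul_ne_zero ha hb, mul_smul_mem_of_G2Perm_block hP hP₀ heP haP hbP⟩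
      · exact .inr (mul_zero a)
      · exact .inr (zero_mul b)
      · exact .inr (mul_zero 0)
    · rintro a (⟨ha, haP⟩ | rfl)
      · exact .inl ⟨inv_ne_zero ha, inv_smul_mem_of_G2Perm_block hP hP₀ heP haP⟩
      · exact .inr inv_zero
  have hLK : L = lineBlock K 0 e₁ := by
    rw [hL]
    ext x
    simp only [lineBlock, zero_add, sub_zero]
    constructor
    · rintro (hx | rfl)
      · obtain ⟨c, rfl⟩ := hline x hx
        refine ⟨c, .inl ⟨?_, hx⟩, rfl⟩
        rintro rfl
        exact hP₀ hx (zero_smul F e₁)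
      · exact ⟨0, hK.zero_mem, (zero_smul F e₁).symm⟩
    · rintro ⟨a, ⟨-, ha⟩ | rfl, rfl⟩
      · exact .inl ha
      · exact .inr (zero_smul F e₁)
  have hcard : K.ncard = P.ncard + 1 := by
    rw [← ncard_lineBlock he.symm, ← hLK, hL, Set.union_singleton,
      Set.ncard_insert_of_notMem (fun h => hP₀ h rfl)]
  have hw : (Pi.single 1 1 : Fin 6 → F) ∉ Submodule.span F {e₁} := by
    rw [Submodule.mem_span_singleton, he₁]
    rintro ⟨a, ha⟩
    simpa using congrFun ha 1
  obtain rfl : 𝓑 = lineBlocks (Fin 6 → F) K := by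
    rw [h𝓑, hLK, orbit_lineBlock hK hG hG2 he.symm]
  obtain rfl : Ω = lineFlags (Fin 6 → F) K := by
    rw [hΩ, hLK, orbit_lineFlag hK hG hG2 he.symm]
  refine ⟨⟨fun z hz => ?_, ?_⟩, ?_, ⟨_, ?_, flagPairs_lineFlags_eq_orbit hK hG hG2 he.symm⟩,
    not_preconnected_flagGraph_lineFlags hK he hw⟩
  · obtain ⟨c, rfl⟩ := hline z hz
    exact Submodule.smul_mem _ _ (Submodule.mem_span_singleton_self e₁)
  · refine ⟨{ carrier := {a : Fˣ | (a : F) • e₁ ∈ P}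
              one_mem' := by simpa using heP
              mul_mem' := fun ha hb => mul_smul_mem_of_G2Perm_block hP hP₀ heP ha hb
              inv_mem' := fun {a} ha => ?_ }, rfl⟩
    have := inv_smul_mem_of_G2Perm_block hP hP₀ heP ha
    rwa [← Units.val_inv_eq_inv_val] at this
  · obtain ⟨l, h1, h2, h3⟩ := exists_isDesign_two_lineBlocks (V := Fin 6 → F) hK
    have hV : Nat.card (Fin 6 → F) = Fintype.card F ^ 6 := by simp
    rw [hcard, hV] at h1
    rw [hcard] at h2
    refine ⟨l, h1, ?_, h2, isStronglyFeasible_lineFlags hK hG hG2 he hw, h3⟩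
    intro g B hB
    rw [h𝓑] at hB ⊢
    exact MulAction.mem_orbit_of_mem_orbit g hB
  · rw [flagPairs_lineFlags_eq_orbit hK hG hG2 he.symm]
    exact MulAction.mem_orbit_self _
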